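/- A \emph{minion} $\mathcal M$ consists of non-empty sets $\mathcal M^{(n)}$, $n\ge 1$, and maps $\mathcal M^{(n)}\to\mathcal M^{(m)}$, $f\mapsto f^\pi$, for all $\pi\colon\{1,\dots,n\}\to\{1,\dots,m\}$, with $f^{\mathrm{id}}=f$ and $(f^\sigma)^\pi=f^{\pi\circ\sigma}$; a \emph{minion homomorphism} is a family of arity-preserving maps that commute with all operations $(\cdot)^\pi$. A $\mathbb Z_2$-action on a space or simplicial set is a (continuous or simplicial) involution $\nu$; powers carry the diagonal action, and maps commuting with $\nu$ are called equivariant. Let $\ell\ge 3$ be odd. We use the following notation. - $\mathrm{pol}(C_\ell,K_4)$: the graph homomorphisms $C_\ell^n\to K_4$, with $f^\pi(x)=f(x\circ\pi)$, where $C_\ell^n$ is the $n$-fold (categorical) product of the $\ell$-cycle. - $\Gamma_{4\ell}$: the order complex of the poset on $\mathbb Z/4\ell$ in which $a\prec b$ iff $a$ is even, $b$ is odd and $a-b=\pm1$; the involution is $x\mapsto x+2\ell$. - $\Sigma^2$: the simplicial set whose $k$-simplices are the $(k+1)$-tuples of two colours with at most $2$ alternations; the involution swaps the colours, and $|\Sigma^2|\cong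 S^2$. - $\mathrm{spol}(\Gamma_{4\ell},\Sigma^2)$: the equivariant simplicial maps $\Gamma_{4\ell}^n\to\Sigma^2$, with the minors $f^\pi(x)=f(x\circ\pi)$. - $Y$: the Eilenberg--MacLane $\mathbb Z_2$-space obtained from $Y_3=|\Sigma^2|$ by letting $Y_{i+1}$, for $i\ge 3$, arise from $Y_i$ by attaching one $(i+1)$-disc $D_\alpha$ along every continuous map $\alpha\colon S^i\to Y_i$, where $\nu$ sends $D_\alpha$ identically onto $D_{\nu\circ\alpha}$, and $Y=\bigcup_i Y_i$ with the weak topology; $j\colon|\Sigma^2|\to Y$ is the inclusion. - $\mathrm{hpol}(S^1,Y)$: the sets $[T^n,Y]_{\mathbb Z_2}$ of equivariant homotopy classes of equivariant maps $T^n=(S^1)^n\to Y$, with the minors $[f]^\pi=[x\mapsto f(x\circ\pi)]$; here $S^1\subset\mathbb C$ carries the antipodal involution. - $\mathrm{Hom}(K_2,G)$: the order complex of the poset of multihomomorphisms $m$ from $K_2$ to $G$, i.e. of pairs of non-empty sets $m(1),m(2)\subseteq V(G)$ with every vertex of $m(1)$ adjacent to every vertex of $m(2)$, ordered by inclusion;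 the involution swaps $m(1)$ and $m(2)$. \textbf{Lemma.} $\mathrm{pol}(C_\ell,K_4)$, $\mathrm{spol}(\Gamma_{4\ell},\Sigma^2)$ and $\mathrm{hpol}(S^1,Y)$ are minions, and there are minion homomorphisms $$\varphi\colon\mathrm{pol}(C_\ell,K_4)\to\mathrm{hpol}(S^1,Y),\qquad \eta\colon\mathrm{spol}(\Gamma_{4\ell},\Sigma^2)\to\mathrm{hpol}(S^1,Y)$$ with $\operatorname{im}\varphi\subseteq\operatorname{im}\eta$, i.e. for each polymorphism $f\colon C_\ell^n\to K_4$ there is an equivariant simplicial map $g\colon\Gamma_{4\ell}^n\to\Sigma^2$ with $\varphi(f)=\eta(g)$. Moreover, they can be chosen as follows. 1. There are an equivariant homeomorphism $h\colon S^1\to|\Gamma_{4\ell}|$ and, for each $n\ge1$, a homeomorphism $T^n\cong|\Gamma_{4\ell}^n|$ whose composition with the $i$-th projection $|\Gamma_{4\ell}^n|\to|\Gamma_{4\ell}|$ is $z\mapsto h(z_i)$, such that $\eta(g)$ is the class of the composition $T^n\cong|\Gamma_{4\ell}^n|\xrightarrow{|g|}|\Sigma^2|\xrightarrow{j}Y$.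 2. There are an equivariant isomorphism $e\colon\Gamma_{4\ell}\to\mathrm{Hom}(K_2,C_\ell)$ and an equivariant simplicial map $t\colon\mathrm{Hom}(K_2,K_4)\to\Sigma^2$ such that $\varphi(f)=\eta(\mu(f))$, where $\mu(f)$ is the composition $$\Gamma_{4\ell}^n\xrightarrow{e^n}\mathrm{Hom}(K_2,C_\ell)^n\to\mathrm{Hom}(K_2,K_4)\xrightarrow{t}\Sigma^2$$ whose middle map sends vertices $(m_1,\dots,m_n)$ to $u\mapsto\{f(v_1,\dots,v_n): v_i\in m_i(u)\}$. -/

import Mathlib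

open CategoryTheory

namespace EqTop

/-! ### Minions -/

/-- A family of sets indexed by arities `n > 0` with functorial minor maps. -/
structure MinorSystem where
  obj : ℕ+ → Type
  minor : ∀ {n m : ℕ+}, (Fin n → Fin m) → obj n → obj m
  minor_id : ∀ {n : ℕ+} (f : obj n), minor id f = f
  minor_comp : ∀ {n m k : ℕ+} (σ : Fin n → Fin m) (π : Fin m → Fin k) (f : obj n),
    minor π (minor σ f) = minor (π ∘ σ) f

/-- An (abstract) minion is a minor system all of whose sets are non-empty. -/
def MinorSystem.IsMinion (M : MinorSystem) : Prop := ∀ n : ℕ+, Nonempty (M.obj n)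

/-- Minion homomorphisms: arity-preserving maps that commute with taking minors. -/
structure MinionHom (M N : MinorSystem) where
  app : ∀ n : ℕ+, M.obj n → N.obj n
  map_minor : ∀ {n m : ℕ+} (π : Fin n → Fin m) (f : M.obj n),
    app m (M.minor π f) = N.minor π (app n f)

/-! ### Polymorphisms of graphs -/

/-- The minion `pol(G, H)` of graph homomorphisms `G ^ n → H`. -/
def pol {V W : Type} (G : SimpleGraph V) (H : SimpleGraph W) : MinorSystem where
  obj n := {f : (Fin n → V) → W // ∀ u v : Fin n → V, (∀ i, G.Adj (u i) (v i)) → H.Adj (f u) (f v)}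
  minor {_ m} π f := ⟨fun (x : Fin m → V) => f.1 (x ∘ π),
    fun (u v : Fin m → V) h => f.2 (u ∘ π) (v ∘ π) fun i => h (π i)⟩
  minor_id _ := rfl
  minor_comp _ _ _ := rfl

/-! ### Topological spaces with an involution -/

/-- A topological space with an action of the group of order two, given by a continuous
involution. -/
structure Z2Space where
  carrier : Type
  [top : TopologicalSpace carrier]
  inv : C(carrier, carrier)
  inv_inv : ∀ x, inv (inv x) = x

attribute [instance] Z2Space.top

instance : CoeSort Z2Space Type := ⟨Z2Space.carrier⟩

/-- A continuous map is equivariant if it commutes with the involutions. -/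
def Z2Space.IsEquivariant {X Y : Z2Space} (f : C(X, Y)) : Prop :=
  ∀ x, f (X.inv x) = Y.inv (f x)

/-- Equivariant continuous maps. -/
abbrev Z2Space.Map (X Y : Z2Space) : Type := {f : C(X, Y) // Z2Space.IsEquivariant f}

/-- Two equivariant maps are identified when there is a homotopy between them through
equivariant maps. -/
instance Z2Space.homotopySetoid (X Y : Z2Space) : Setoid (Z2Space.Map X Y) where
  r f g := ContinuousMap.HomotopicWith f.1 g.1 Z2Space.IsEquivariant
  iseqv :=
    { refl := fun f => ContinuousMap.HomotopicWith.refl f.1 f.2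
      symm := fun h => h.symm
      trans := fun h₁ h₂ => h₁.trans h₂ }

/-- The set `[X, Y]` of equivariant homotopy classes of equivariant maps. -/
def Z2Space.Classes (X Y : Z2Space) : Type := Quotient (Z2Space.homotopySetoid X Y)

/-- The power `X ^ n` with the diagonal involution. -/
def Z2Space.pow (X : Z2Space) (n : ℕ) : Z2Space where
  carrier := Fin n → X
  inv := ⟨fun x i => X.inv (x i), by fun_prop⟩
  inv_inv x := funext fun i => X.inv_inv (x i)

/-- The map `X ^ m → X ^ n`, `x ↦ x ∘ π`. -/
def Z2Space.powMap (X : Z2Space) {n m : ℕ} (π : Fin n → Fin m) : C(X.pow m, X.pow n) :=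
  ⟨fun x i => x (π i), continuous_pi fun i => continuous_apply (π i)⟩

/-- The `π`-minor of an equivariant map `X ^ n → Y`. -/
def Z2Space.Map.minor {X Y : Z2Space} {n m : ℕ} (π : Fin n → Fin m)
    (f : Z2Space.Map (X.pow n) Y) : Z2Space.Map (X.pow m) Y :=
  ⟨f.1.comp (X.powMap π), fun x => f.2 (X.powMap π x)⟩

/-- The minion `hpol(X, Y)` of equivariant homotopy classes of equivariant maps `X ^ n → Y`. -/
def hpol (X Y : Z2Space) : MinorSystem where
  obj n := Z2Space.Classes (X.pow n) Y
  minor {n m} π := Quotient.map (Z2Space.Map.minor π) (by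
    rintro f g ⟨H⟩
    exact ⟨{ toFun := fun p => H (p.1, X.powMap π p.2)
             continuous_toFun := by fun_prop
             map_zero_left := fun x => H.map_zero_left (X.powMap π x)
             map_one_left := fun x => H.map_one_left (X.powMap π x)
             prop' := fun t x => H.prop' t (X.powMap π x) }⟩)
  minor_id f := by
    induction f using Quotient.inductionOn with
    | h f => rfl
  minor_comp σ π f := by
    induction f using Quotient.inductionOn with
    | h f => rfl

/-- The unit circle in the complex plane with the antipodal involution. -/
noncomputable def circle : Z2Space where
  carrier := Circle
  inv := ⟨fun z => -z, continuous_neg⟩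
  inv_inv := neg_neg

/-! ### Simplicial sets with an involution -/

/-- A simplicial set with a simplicial involution. -/
structure Z2SSet where
  sset : SSet.{0}
  inv : sset ⟶ sset
  inv_inv : inv ≫ inv = 𝟙 sset

/-- Equivariant simplicial maps. -/
abbrev Z2SSet.Map (X Y : Z2SSet) : Type := {f : X.sset ⟶ Y.sset // X.inv ≫ f = f ≫ Y.inv}

/-- The power `X ^ n` of a simplicial set: its `k`-simplices are the `n`-tuples of
`k`-simplices of `X`. -/
def spow (X : SSet.{0}) (n : ℕ) : SSet.{0} where
  obj U := Fin n → X.obj U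
  map α := TypeCat.ofHom fun σ i => X.map α (σ i)
  map_id U := by ext σ; simp
  map_comp α β := by ext σ; simp

/-- The `i`-th projection `X ^ n → X`. -/
def spowProj (X : SSet.{0}) (n : ℕ) (i : Fin n) : spow X n ⟶ X where
  app U := TypeCat.ofHom fun σ => σ i

/-- The map `X ^ m → X ^ n`, `x ↦ x ∘ π`. -/
def spowMap (X : SSet.{0}) {n m : ℕ} (π : Fin n → Fin m) : spow X m ⟶ spow X n where
  app U := TypeCat.ofHom fun σ i => σ (π i)

/-- The map `f ^ n : X ^ n → Y ^ n`. -/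
def spowCongr {X Y : SSet.{0}} (f : X ⟶ Y) (n : ℕ) : spow X n ⟶ spow Y n where
  app U := TypeCat.ofHom fun σ i => f.app U (σ i)
  naturality U V α := by
    ext σ
    funext i
    exact ConcreteCategory.congr_hom (f.naturality α) (σ i)

/-- The power `X ^ n` with the diagonal involution. -/
def Z2SSet.pow (X : Z2SSet) (n : ℕ) : Z2SSet where
  sset := spow X.sset n
  inv := spowCongr X.inv n
  inv_inv := by
    ext U σ
    funext i
    exact ConcreteCategory.congr_hom (NatTrans.congr_app X.inv_inv U) (σ i)

/-- The minion `spol(X, Y)` of equivariant simplicial maps `X ^ n → Y`. -/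
def spol (X Y : Z2SSet) : MinorSystem where
  obj n := Z2SSet.Map (X.pow n) Y
  minor π f := ⟨spowMap X.sset π ≫ f.1, by
    ext U σ
    exact ConcreteCategory.congr_hom (NatTrans.congr_app f.2 U) fun i => σ (π i)⟩
  minor_id f := rfl
  minor_comp σ π f := rfl

/-- The geometric realization, with the induced involution. -/
noncomputable def Z2SSet.realization (X : Z2SSet) : Z2Space where
  carrier := SSet.toTop.obj X.sset
  inv := (SSet.toTop.map X.inv).hom
  inv_inv x := by
    have h : SSet.toTop.map X.inv ≫ SSet.toTop.map X.inv = 𝟙 _ := by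
      rw [← CategoryTheory.Functor.map_comp, X.inv_inv, CategoryTheory.Functor.map_id]
    exact ConcreteCategory.congr_hom h x

/-- The continuous map between geometric realizations induced by a simplicial map. -/
noncomputable def realize {X Y : SSet.{0}} (f : X ⟶ Y) :
    C(SSet.toTop.obj X, SSet.toTop.obj Y) := (SSet.toTop.map f).hom

/-! ### The spheres `Σ^k` -/

/-- The number of alternations in a tuple with entries in the two-element set. -/
def alternations {m : ℕ} (u : Fin (m + 1) → Bool) : ℕ :=
  (Finset.univ.filter fun i : Fin m => u i.castSucc ≠ u i.succ).card

theorem exists_alternation {m : ℕ} (u : Fin (m + 1) → Bool) (a b : Fin (m + 1)) (hab : a ≤ b)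
    (h : u a ≠ u b) : ∃ j : Fin m, a ≤ j.castSucc ∧ j.succ ≤ b ∧ u j.castSucc ≠ u j.succ := by
  induction b using Fin.induction with
  | zero =>
    have : a = 0 := le_antisymm hab (Fin.zero_le _)
    exact absurd (by rw [this]) h
  | succ j ih =>
    rcases hab.lt_or_eq with hlt | rfl
    · have haj : a ≤ j.castSucc := by
        rw [Fin.le_def]
        rw [Fin.lt_def] at hlt
        simp at hlt ⊢
        omega
      by_cases hj : u j.castSucc = u j.succ
      · obtain ⟨k, h1, h2, h3⟩ := ih haj (by rw [hj]; exact h)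
        refine ⟨k, h1, h2.trans ?_, h3⟩
        rw [Fin.le_def]
        simp
      · exact ⟨j, haj, le_rfl, hj⟩
    · exact absurd rfl h

theorem alternations_comp_le {m k : ℕ} (u : Fin (m + 1) → Bool) (α : Fin (k + 1) →o Fin (m + 1)) :
    alternations (u ∘ α) ≤ alternations u := by
  classical
  have key : ∀ i : Fin k, (u ∘ α) i.castSucc ≠ (u ∘ α) i.succ →
      ∃ j : Fin m, α i.castSucc ≤ j.castSucc ∧ j.succ ≤ α i.succ ∧ u j.castSucc ≠ u j.succ :=
    fun i hi => exists_alternation u _ _ (α.monotone (Fin.castSucc_lt_succ).le) hi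
  rcases isEmpty_or_nonempty (Fin m) with hm | hm
  · have h0 : alternations (u ∘ α) = 0 := by
      rw [alternations, Finset.card_eq_zero, Finset.filter_eq_empty_iff]
      intro i _ hi
      exact hm.elim (key i hi).choose
    rw [h0]
    exact Nat.zero_le _
  choose! f h1 h2 h3 using key
  refine Finset.card_le_card_of_injOn f ?_ ?_
  · intro i hi
    simp only [Finset.coe_filter, Finset.mem_univ, true_and, Set.mem_ofPred_eq] at hi ⊢
    exact h3 i hi
  · have aux : ∀ i i' : Fin k, (u ∘ α) i.castSucc ≠ (u ∘ α) i.succ →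
        (u ∘ α) i'.castSucc ≠ (u ∘ α) i'.succ → i < i' → f i < f i' := by
      intro i i' hi hi' hlt
      have e : α i.succ ≤ α i'.castSucc := α.monotone (by
        rw [Fin.le_def]; rw [Fin.lt_def] at hlt; simpa using hlt)
      have := (h2 i hi).trans (e.trans (h1 i' hi'))
      rw [Fin.le_def] at this
      rw [Fin.lt_def]
      simpa using this
    intro i hi i' hi' heq
    simp only [Finset.coe_filter, Finset.mem_univ, true_and, Set.mem_ofPred_eq] at hi hi'
    rcases lt_trichotomy i i' with hlt | heq' | hlt
    · exact absurd heq (aux i i' hi hi' hlt).ne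
    · exact heq'
    · exact absurd heq (aux i' i hi' hi hlt).ne'

/-- The simplicial set `Σ^k`: its `n`-simplices are the `(n + 1)`-tuples of two colours
with at most `k` alternations. The involution swaps the colours. -/
def sigma (k : ℕ) : Z2SSet where
  sset :=
    { obj := fun U => {u : Fin (U.unop.len + 1) → Bool // alternations u ≤ k}
      map := fun α => TypeCat.ofHom fun u =>
        ⟨u.1 ∘ α.unop.toOrderHom, (alternations_comp_le u.1 α.unop.toOrderHom).trans u.2⟩
      map_id := fun U => rfl
      map_comp := fun α β => rfl }
  inv :=
    { app := fun U => TypeCat.ofHom fun u => ⟨fun i => !(u.1 i), by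
        have h : alternations (fun i => !(u.1 i)) = alternations u.1 := by
          simp [alternations]
        exact h.trans_le u.2⟩
      naturality := fun U V α => rfl }
  inv_inv := by
    ext U u
    rename_i i
    exact Bool.not_not (u.1 i)

/-! ### Order complexes and the cycles `Γ_L` -/

/-- The order complex of a poset is its nerve; a monotone involution of the poset induces a
simplicial involution. -/
def orderComplex (P : Type) [PartialOrder P] (ν : P →o P) (hν : ∀ x, ν (ν x) = x) : Z2SSet where
  sset := nerve P
  inv := nerveMap ν.monotone.functor
  inv_inv := by
    have h : ν.monotone.functor ⋙ ν.monotone.functor = 𝟭 P :=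
      CategoryTheory.Functor.ext (fun x => hν x) (fun _ _ _ => Subsingleton.elim _ _)
    change nerveMap (ν.monotone.functor ⋙ ν.monotone.functor) = _
    rw [h]
    rfl

/-- The elements of the poset `(ℤ/L, ≼)`. -/
structure GammaVertex (L : ℕ) where
  val : ZMod L

theorem GammaVertex.ext' {L : ℕ} {a b : GammaVertex L} (h : a.val = b.val) : a = b := by
  cases a; cases b; cases h; rfl

/-- `a ≺ b` iff `a` is even, `b` is odd and `a - b = ± 1` modulo `L`. -/
instance (L : ℕ) : PartialOrder (GammaVertex L) where
  le a b := a = b ∨ (Even a.val.val ∧ Odd b.val.val ∧ (a.val - b.val = 1 ∨ a.val - b.val = -1))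
  le_refl a := Or.inl rfl
  le_trans a b c := by
    rintro (rfl | ⟨h1, h2, h3⟩) (rfl | ⟨h4, h5, h6⟩)
    · exact Or.inl rfl
    · exact Or.inr ⟨h4, h5, h6⟩
    · exact Or.inr ⟨h1, h2, h3⟩
    · exact absurd h2 (Nat.not_odd_iff_even.2 h4)
  le_antisymm a b := by
    rintro (rfl | ⟨h1, h2, h3⟩) (h | ⟨h4, h5, h6⟩)
    · rfl
    · rfl
    · exact h.symm
    · exact absurd h2 (Nat.not_odd_iff_even.2 h4)

theorem even_val_shift {L : ℕ} (hL : 4 ∣ L) (a : ZMod L) :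
    Even (a + ((L / 2 : ℕ) : ZMod L)).val ↔ Even a.val := by
  obtain ⟨k, rfl⟩ := hL
  rcases Nat.eq_zero_or_pos k with rfl | hk
  · simp
  · have : NeZero (4 * k) := ⟨by omega⟩
    rw [ZMod.val_add, ZMod.val_natCast, Nat.even_iff, Nat.even_iff]
    have h2 : 2 ∣ 4 * k := ⟨2 * k, by ring⟩
    rw [Nat.mod_mod_of_dvd _ h2, Nat.add_mod, Nat.mod_mod_of_dvd _ h2]
    have : 4 * k / 2 % 2 = 0 := by omega
    rw [this]
    omega

/-- The map `x ↦ x + L / 2`. -/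
def gammaShift (L : ℕ) (hL : 4 ∣ L) : GammaVertex L →o GammaVertex L where
  toFun a := ⟨a.val + ((L / 2 : ℕ) : ZMod L)⟩
  monotone' a b := by
    rintro (rfl | ⟨h1, h2, h3⟩)
    · exact le_rfl
    · refine Or.inr ⟨(even_val_shift hL _).2 h1, ?_, ?_⟩
      · rw [← Nat.not_even_iff_odd] at h2 ⊢
        exact fun h => h2 ((even_val_shift hL _).1 h)
      · simpa using h3

/-- The simplicial set `Γ_L`, for `L` divisible by `4`, with the antipodal involution. -/
def gamma (L : ℕ) (hL : 4 ∣ L) : Z2SSet :=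
  orderComplex (GammaVertex L) (gammaShift L hL) (fun a => GammaVertex.ext' (by
    have h : L / 2 + L / 2 = L := by omega
    change a.val + ((L / 2 : ℕ) : ZMod L) + ((L / 2 : ℕ) : ZMod L) = a.val
    rw [add_assoc, ← Nat.cast_add, h, ZMod.natCast_self, add_zero]))

/-- The simplicial set `Γ_{4ℓ}`. -/
abbrev gammaFour (ℓ : ℕ) : Z2SSet := gamma (4 * ℓ) (Dvd.intro ℓ rfl)

/-! ### Homomorphism complexes -/

/-- Multihomomorphisms from `F` to `G`, ordered by componentwise inclusion. -/
def MultiHom {V W : Type} (F : SimpleGraph V) (G : SimpleGraph W) : Type :=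
  {m : V → Set W // (∀ u, (m u).Nonempty) ∧
    ∀ u v, F.Adj u v → ∀ a ∈ m u, ∀ b ∈ m v, G.Adj a b}

instance {V W : Type} (F : SimpleGraph V) (G : SimpleGraph W) : PartialOrder (MultiHom F G) :=
  inferInstanceAs (PartialOrder {m : V → Set W // (∀ u, (m u).Nonempty) ∧
    ∀ u v, F.Adj u v → ∀ a ∈ m u, ∀ b ∈ m v, G.Adj a b})

/-- The graph `K₂`. -/
abbrev K2 : SimpleGraph (Fin 2) := ⊤

/-- The graph `K₄`. -/
abbrev K4 : SimpleGraph (Fin 4) := ⊤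

/-- The cycle `C_ℓ`. -/
abbrev cycle (ℓ : ℕ) : SimpleGraph (Fin ℓ) := SimpleGraph.cycleGraph ℓ

/-- Swapping the two vertices of `K₂`. -/
def multiHomSwap {W : Type} (G : SimpleGraph W) : MultiHom K2 G →o MultiHom K2 G where
  toFun m := ⟨m.1 ∘ Equiv.swap (0 : Fin 2) 1, fun _ => m.2.1 _, fun _ _ h =>
    m.2.2 _ _ ((SimpleGraph.top_adj _ _).2 fun e =>
      (SimpleGraph.top_adj _ _).1 h ((Equiv.swap (0 : Fin 2) 1).injective e))⟩
  monotone' _ _ h u := h (Equiv.swap (0 : Fin 2) 1 u)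

/-- The homomorphism complex `Hom(K₂, G)` with its involution. -/
def homComplex {W : Type} (G : SimpleGraph W) : Z2SSet :=
  orderComplex (MultiHom K2 G) (multiHomSwap G) (fun m => Subtype.ext (funext fun u => by
    change m.1 (Equiv.swap (0 : Fin 2) 1 (Equiv.swap (0 : Fin 2) 1 u)) = m.1 u
    rw [Equiv.swap_apply_self]))

/-- The image of a tuple of multihomomorphisms under a polymorphism `f`:
`u ↦ {f (v₁, …, vₙ) | vᵢ ∈ mᵢ(u)}`. -/
def multiHomPush {V W : Type} {G : SimpleGraph V} {H : SimpleGraph W} {n : ℕ+}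
    (f : (pol G H).obj n) (m : Fin n → MultiHom K2 G) : MultiHom K2 H :=
  ⟨fun u => {w | ∃ v : Fin n → V, (∀ i, v i ∈ (m i).1 u) ∧ f.1 v = w},
    fun u => ⟨_, fun i => ((m i).2.1 u).some, fun i => ((m i).2.1 u).some_mem, rfl⟩, by
      rintro u v huv _ ⟨a, ha, rfl⟩ _ ⟨b, hb, rfl⟩
      exact f.2 _ _ fun i => (m i).2.2 u v huv _ (ha i) _ (hb i)⟩

theorem multiHomPush_mono {V W : Type} {G : SimpleGraph V} {H : SimpleGraph W} {n : ℕ+}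
    (f : (pol G H).obj n) : Monotone (multiHomPush f) := by
  rintro m m' h u w ⟨v, hv, rfl⟩
  exact ⟨v, fun i => h i u (hv i), rfl⟩

/-- The equivariant simplicial map `Hom(K₂, G) ^ n → Hom(K₂, H)` induced by an `n`-ary
polymorphism. -/
def homComplexPush {V W : Type} {G : SimpleGraph V} {H : SimpleGraph W} {n : ℕ+}
    (f : (pol G H).obj n) : (spol (homComplex G) (homComplex H)).obj n :=
  ⟨{ app := fun U => TypeCat.ofHom fun (σ : Fin n → (nerve (MultiHom K2 G)).obj U) =>
      (show (nerve (MultiHom K2 H)).obj U from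
        Monotone.functor (f := fun a => multiHomPush f fun i => (σ i).obj a)
          (fun a b hab => multiHomPush_mono f fun i => leOfHom ((σ i).map (homOfLE hab))))
     naturality := fun U V' α => rfl }, by
    ext U σ
    exact CategoryTheory.Functor.ext (fun a => rfl) (fun _ _ _ => Subsingleton.elim _ _)⟩

/-- For equivariant simplicial maps `e : X → Hom(K₂, G)` and `t : Hom(K₂, H) → Z`, the
equivariant simplicial map `X ^ n → Hom(K₂, G) ^ n → Hom(K₂, H) → Z` associated with a
polymorphism `f : G ^ n → H`. -/
def polToSpol {V W : Type} {G : SimpleGraph V} {H : SimpleGraph W} {X Z : Z2SSet}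
    (e : Z2SSet.Map X (homComplex G)) (t : Z2SSet.Map (homComplex H) Z) {n : ℕ+}
    (f : (pol G H).obj n) : (spol X Z).obj n :=
  ⟨spowCongr e.1 n ≫ (homComplexPush f).1 ≫ t.1, by
    apply NatTrans.ext
    funext U
    refine ConcreteCategory.hom_ext _ _ fun σ => ?_
    have h₁ : (spowCongr e.1 n).app U ((X.pow n).inv.app U σ) =
        ((homComplex G).pow n).inv.app U ((spowCongr e.1 n).app U σ) :=
      funext fun i => ConcreteCategory.congr_hom (NatTrans.congr_app e.2 U) (σ i)
    have h₂ := ConcreteCategory.congr_hom (NatTrans.congr_app (homComplexPush f).2 U)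
      ((spowCongr e.1 n).app U σ)
    have h₃ := ConcreteCategory.congr_hom (NatTrans.congr_app t.2 U)
      ((homComplexPush f).1.app U ((spowCongr e.1 n).app U σ))
    exact (congrArg (fun y => t.1.app U ((homComplexPush f).1.app U y)) h₁).trans
      ((congrArg (fun y => t.1.app U y) h₂).trans h₃)⟩

/-! ### The Eilenberg–MacLane space `Y` -/

/-- The sphere `S ^ n`. -/
abbrev Sph (n : ℕ) : Type := Metric.sphere (0 : EuclideanSpace ℝ (Fin (n + 1))) 1

/-- The disc `D ^ (n + 1)`. -/
abbrev Disc (n : ℕ) : Type := Metric.closedBall (0 : EuclideanSpace ℝ (Fin (n + 1))) 1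

/-- The inclusion of the boundary sphere into the disc. -/
def sphToDisc (n : ℕ) (x : Sph n) : Disc n := ⟨x.1, Metric.sphere_subset_closedBall x.2⟩

/-- The relation that glues, for every continuous map `α : S ^ n → X`, the boundary of a
disc `D ^ (n + 1)` to `X` along `α`. -/
inductive AttachRel (X : Z2Space) (n : ℕ) :
    (X ⊕ (Σ _ : C(Sph n, X), Disc n)) → (X ⊕ (Σ _ : C(Sph n, X), Disc n)) → Prop
  | glue (α : C(Sph n, X)) (x : Sph n) :
      AttachRel X n (Sum.inr ⟨α, sphToDisc n x⟩) (Sum.inl (α x))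

/-- The involution before gluing: it acts on `X` and sends the disc with index `α` identically
onto the disc with index `ν ∘ α`. -/
def attachPre (X : Z2Space) (n : ℕ) :
    (X ⊕ (Σ _ : C(Sph n, X), Disc n)) → (X ⊕ (Σ _ : C(Sph n, X), Disc n)) :=
  Sum.map X.inv fun p => ⟨X.inv.comp p.1, p.2⟩

theorem continuous_attachPre (X : Z2Space) (n : ℕ) : Continuous (attachPre X n) :=
  Continuous.sumMap X.inv.continuous 
    (continuous_sigma fun α => continuous_sigmaMk (σ := fun _ : C(Sph n, X) => Disc n)
      (i := X.inv.comp α))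

/-- The space obtained from `X` by attaching one `(n + 1)`-dimensional disc along every
continuous map `S ^ n → X`; the involution permutes the discs. -/
def attachCells (X : Z2Space) (n : ℕ) : Z2Space where
  carrier := Quot (AttachRel X n)
  inv := ⟨Quot.map (attachPre X n) (by
      rintro _ _ ⟨α, x⟩
      exact AttachRel.glue (X.inv.comp α) x),
    continuous_quot_lift _ (continuous_quot_mk.comp (continuous_attachPre X n))⟩
  inv_inv x := by
    induction x using Quot.ind with
    | mk x =>
      refine congrArg (Quot.mk _) ?_
      rcases x with x | ⟨α, x⟩
      · exact congrArg Sum.inl (X.inv_inv x)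
      · have h : X.inv.comp (X.inv.comp α) = α := ContinuousMap.ext fun y => X.inv_inv _
        change Sum.inr (⟨X.inv.comp (X.inv.comp α), x⟩ : Σ _ : C(Sph n, X), Disc n) = _
        rw [h]

/-- The inclusion of `X` into the space with cells attached. -/
def attachIncl (X : Z2Space) (n : ℕ) (x : X) : attachCells X n := Quot.mk _ (Sum.inl x)

/-- The skeleta of `Y`: start with the sphere `|Σ²|`; at step `k` attach `(k + 4)`-dimensional
discs so as to kill the homotopy group of degree `k + 3`. -/
noncomputable def emStage : ℕ → Z2Space
  | 0 => (sigma 2).realization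
  | k + 1 => attachCells (emStage k) (k + 3)

/-- The relation that identifies each stage with its image in the next one. -/
inductive EMRel : (Σ k, emStage k) → (Σ k, emStage k) → Prop
  | step (k : ℕ) (x : emStage k) :
      EMRel ⟨k, x⟩ ⟨k + 1, attachIncl (emStage k) (k + 3) x⟩

/-- The space `Y`, the union of its skeleta with the weak topology. -/
noncomputable def emSpace : Z2Space where
  carrier := Quot EMRel
  inv := ⟨Quot.map (fun p => ⟨p.1, (emStage p.1).inv p.2⟩) (by
      rintro _ _ ⟨k, x⟩
      exact EMRel.step k _),
    continuous_quot_lift _ (continuous_quot_mk.comp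
      (continuous_sigma fun k => continuous_sigmaMk.comp (emStage k).inv.continuous))⟩
  inv_inv x := by
    induction x using Quot.ind with
    | mk x =>
      obtain ⟨k, x⟩ := x
      exact congrArg (fun y => Quot.mk EMRel ⟨k, y⟩) ((emStage k).inv_inv x)

/-- The inclusion `j : |Σ²| → Y`. -/
noncomputable def emIncl : Z2Space.Map (sigma 2).realization emSpace :=
  ⟨⟨fun x => Quot.mk EMRel ⟨0, x⟩,
    continuous_quot_mk.comp (continuous_sigmaMk (σ := fun k => emStage k) (i := 0))⟩,
    fun _ => rfl⟩

end EqTop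

open EqTop

/-!
The proof rests on two facts about realizations of order complexes of finite posets: they commute
with finite products, and a pointwise inequality of simplicial maps into an order complex gives a
homotopy. The space `Y` enters only through the equivariant map `j`: every homotopy that is needed
already exists in `|Σ²|`.

*Realizations.* A point of `|X|` is given by a simplex and barycentric coordinates on it
(`exists_cell`), and continuous maps out of `|X|` are compatible families of maps on simplices
(`exists_desc`). Barycentric coordinates `t` on a simplex cut `[0, 1)` into consecutive intervals of
lengths `t i`, so a point of the realization of the nerve of a poset `P` amounts to a monotone step
function `[0, 1) → P`. Finitely many step functions are constant on the pieces of a common partition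
(`exists_common_refinement`), and a step function is determined by the weights it gives to the
elements of `P` (`obj_block_eq_of_map_eq`). The former gives surjectivity and the latter injectivity
of the comparison map `|X ^ n| → |X| ^ n` (`bijective_spowProj`) and of its analogue for the
cylinder `X × N{0 < 1}` (`bijective_cylinder`). Compactness of the source and the Hausdorff property
of the target, which embeds into a simplex, turn both bijections into homeomorphisms.

*Homotopies.* Two simplicial maps `A ≤ B` from `X` to a nerve are the ends of a map on the cylinder,
hence `|A|` and `|B|` are homotopic, equivariantly if `A` and `B` are equivariant
(`homotopicWith_of_le`).

*The circle.* The weights of the points of `|Γ_L|` are exactly the functions `p ↦ tent θ p` for `θ`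
on a circle of circumference `L`, so `|Γ_L|` is that circle (`exists_circle_homeo`). With the product
theorem this identifies the torus with `|Γ_L ^ n|` compatibly with projections, and `η` is defined
by realization (`realizationHom`).

*Combinatorics.* For odd `ℓ` the bipartite double cover of `C_ℓ` is a cycle of length `2ℓ`, and a
multihomomorphism `K₂ → C_ℓ` is an edge or the star of a vertex in it (`exists_starMultiHom_eq`);
this is the isomorphism `Γ_{4ℓ} ≅ Hom(K₂, C_ℓ)`. A chain in `Hom(K₂, K₄)` has at most three members,
so every equivariant two-colouring of its vertices is a simplicial map to `Σ²`
(`homComplexToSigma`).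

*The homomorphism `φ`.* The assignment `μ` need not commute with minors. However, the
multihomomorphisms induced by `f ^ π` are contained in the corresponding minors of those induced by
`f`, and the order homotopy shows that `φ = η ∘ μ` commutes with minors (`polHom`).
-/

open CategoryTheory

namespace EqTop

/-! ### Cells of the geometric realization -/

open scoped Simplicial

/-- The characteristic map of a simplex of `X`, from the topological simplex to `|X|`. -/
noncomputable def cell {X : SSet.{0}} {n : ℕ} (s : X _⦋n⦌) :
    C(stdSimplex ℝ (Fin (n + 1)), SSet.toTop.obj X) :=
  (SSet.toTop.map (SSet.yonedaEquiv.symm s)).hom.comp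
    ⟨(SimplexCategory.toTopHomeo ⦋n⦌).symm, (SimplexCategory.toTopHomeo ⦋n⦌).symm.continuous⟩

theorem realize_cell {X Y : SSet.{0}} (f : X ⟶ Y) {n : ℕ} (s : X _⦋n⦌)
    (t : stdSimplex ℝ (Fin (n + 1))) : realize f (cell s t) = cell (f.app _ s) t := by
  change (SSet.toTop.map (SSet.yonedaEquiv.symm s) ≫ SSet.toTop.map f) _ = _
  rw [← Functor.map_comp, SSet.yonedaEquiv_symm_comp]
  rfl

/-- The identifications between the simplices that make up the realization. -/
theorem cell_map {X : SSet.{0}} {n m : ℕ} (f : ⦋n⦌ ⟶ ⦋m⦌) (s : X _⦋m⦌)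
    (t : stdSimplex ℝ (Fin (n + 1))) :
    cell (X.map f.op s) t = cell s (stdSimplex.map f t) := by
  have h := SimplexCategory.toTopHomeo_symm_naturality_apply.{0} f t
  have h' := congrArg (fun φ => SSet.toTop.map φ)
    (SSet.yonedaEquiv_symm_naturality_left (n := ⦋m⦌) f s)
  refine (ConcreteCategory.congr_hom h' ((SimplexCategory.toTopHomeo ⦋n⦌).symm t)).symm.trans ?_
  rw [Functor.map_comp]
  exact congrArg (SSet.toTop.map (SSet.yonedaEquiv.symm s)) h.symm

/-- Under the adjunction with the singular simplicial set, a map on `|X|` corresponds to the family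
of its restrictions to the simplices of `X`. -/
theorem homEquiv_cell {X : SSet.{0}} {Z : TopCat.{0}} (g : SSet.toTop.obj X ⟶ Z) {n : ℕ}
    (s : X _⦋n⦌) (t : stdSimplex ℝ (Fin (n + 1))) :
    Z.toSSetObjEquiv _ ((sSetTopAdj.homEquiv X Z g).app _ s) t = g (cell s t) := by
  rw [Adjunction.homEquiv_unit]
  have h := sSetTopAdj_unit_app_app_down X _ s
  exact congrArg g (ConcreteCategory.congr_hom h (ULift.up t))

/-- A compatible family of maps on simplices glues to a continuous map on the realization. -/
theorem exists_desc {X : SSet.{0}} {Z : Type} [TopologicalSpace Z]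
    (c : ∀ n : ℕ, X _⦋n⦌ → C(stdSimplex ℝ (Fin (n + 1)), Z))
    (hc : ∀ (n m : ℕ) (f : ⦋n⦌ ⟶ ⦋m⦌) (s : X _⦋m⦌) (t : stdSimplex ℝ (Fin (n + 1))),
      c n (X.map f.op s) t = c m s (stdSimplex.map f t)) :
    ∃ g : C(SSet.toTop.obj X, Z), ∀ (n : ℕ) (s : X _⦋n⦌) t, g (cell s t) = c n s t := by
  let φ : X ⟶ TopCat.toSSet.obj (TopCat.of Z) :=
    { app := fun U => TypeCat.ofHom fun s =>
        ((TopCat.of Z).toSSetObjEquiv U).symm (c U.unop.len s)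
      naturality := fun U V α => by
        ext s
        refine ((TopCat.of Z).toSSetObjEquiv V).injective ?_
        ext t
        exact hc _ _ α.unop s t }
  refine ⟨((sSetTopAdj.homEquiv X (TopCat.of Z)).symm φ).hom, fun n s t => ?_⟩
  have h := homEquiv_cell ((sSetTopAdj.homEquiv X (TopCat.of Z)).symm φ) s t
  rw [Equiv.apply_symm_apply] at h
  exact h.symm

/-- Continuous maps on the realization are determined by their restrictions to the simplices. -/
theorem realization_hom_ext {X : SSet.{0}} {Z : Type} [TopologicalSpace Z]
    {g g' : C(SSet.toTop.obj X, Z)}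
    (h : ∀ (n : ℕ) (s : X _⦋n⦌) t, g (cell s t) = g' (cell s t)) : g = g' := by
  have key : TopCat.ofHom g = TopCat.ofHom g' := by
    refine (sSetTopAdj.homEquiv X (TopCat.of Z)).injective ?_
    ext U s
    refine ((TopCat.of Z).toSSetObjEquiv U).injective ?_
    ext t
    refine (homEquiv_cell (TopCat.ofHom g) (n := U.unop.len) s t).trans ?_
    exact (h _ _ _).trans (homEquiv_cell (TopCat.ofHom g') (n := U.unop.len) s t).symm
  exact congrArg TopCat.Hom.hom key

/-- Every point of the realization lies in a simplex. -/
theorem exists_cell {X : SSet.{0}} (x : SSet.toTop.obj X) :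
    ∃ (n : ℕ) (s : X _⦋n⦌) (t : stdSimplex ℝ (Fin (n + 1))), cell s t = x := by
  -- for the indiscrete topology on `Prop`, membership in the union of the simplices is a
  -- continuous map, and it agrees on every simplex with the constant map `True`
  let _ : TopologicalSpace Prop := ⊤
  have h : (⟨fun x => ∃ (n : ℕ) (s : X _⦋n⦌) (t : stdSimplex ℝ (Fin (n + 1))), cell s t = x,
      continuous_top⟩ : C(SSet.toTop.obj X, Prop)) = ⟨fun _ => True, continuous_top⟩ :=
    realization_hom_ext fun n s t => eq_true ⟨n, s, t, rfl⟩
  exact of_eq_true (congrArg (fun g => g x) h)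

/-! ### Weights and common refinements -/

open MeasureTheory

/-- `u` lies in the block of `p` for the weights `t`. For a linear order, the blocks are the
consecutive half-open intervals of lengths `t p` into which `[0, 1)` is cut; the definition for
partial orders is meant for weights whose support is a chain. -/
def IsBlock {P : Type*} [Fintype P] [PartialOrder P] (t : P → ℝ) (u : ℝ) (p : P) : Prop := by
  classical
  exact ∑ q with q < p, t q ≤ u ∧ u < ∑ q with q ≤ p, t q

section
variable {P Q : Type*} [Fintype P] [PartialOrder P] [Fintype Q] [PartialOrder Q]

theorem isBlock_iff [DecidableLT P] [DecidableLE P] {t : P → ℝ} {u : ℝ} {p : P} :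
    IsBlock t u p ↔ ∑ q with q < p, t q ≤ u ∧ u < ∑ q with q ≤ p, t q := by
  unfold IsBlock
  convert Iff.rfl using 3 <;> congr

theorem IsBlock.pos {t : P → ℝ} {u : ℝ} {p : P} (h : IsBlock t u p) : 0 < t p := by
  classical
  rw [isBlock_iff] at h
  have e : (Finset.univ.filter fun q => q ≤ p) = insert p (Finset.univ.filter fun q => q < p) := by
    ext q
    simp [le_iff_eq_or_lt]
  rw [e, Finset.sum_insert (by simp)] at h
  linarith [h.1, h.2]

/-- Blocks of comparable elements are ordered in the same way as the elements. -/
theorem IsBlock.not_block_lt {t : P → ℝ} (ht : ∀ q, 0 ≤ t q) {u v : ℝ} {p q : P}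
    (h : IsBlock t u p) (h' : IsBlock t v q) (huv : u ≤ v) : ¬ q < p := by
  classical
  rw [isBlock_iff] at h h'
  intro hlt
  have : ∑ r with r ≤ q, t r ≤ ∑ r with r < p, t r :=
    Finset.sum_le_sum_of_subset_of_nonneg
      (fun r hr => by simp at hr ⊢; exact hr.trans_lt hlt) fun _ _ _ => ht _
  linarith [h.1, h'.2]

/-- The block of a point is preserved when weights are pushed forward along a monotone map. -/
theorem IsBlock.map {ι : Type*} [Fintype ι] [LinearOrder ι] {f : ι → P} (hf : Monotone f)
    {t : stdSimplex ℝ ι} {u : ℝ} {i : ι} (h : IsBlock t u i) :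
    IsBlock (stdSimplex.map f t) u (f i) := by
  classical
  rw [isBlock_iff] at h ⊢
  have e : ∀ s : Finset P, ∑ q ∈ s, stdSimplex.map f t q = ∑ j with f j ∈ s, t j := by
    intro s
    simp only [stdSimplex.map_coe, FunOnFinite.linearMap_apply_apply]
    rw [Finset.sum_comm' (t' := Finset.univ.filter fun j => f j ∈ s) (s' := fun j => {f j})]
    · simp
    · intro x y; simp; constructor
      · rintro ⟨h1, rfl⟩; exact ⟨rfl, h1⟩
      · rintro ⟨rfl, h1⟩; exact ⟨h1, rfl⟩
  rw [e, e]
  constructor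
  · refine le_trans (Finset.sum_le_sum_of_subset_of_nonneg ?_ fun _ _ _ => t.2.1 _) h.1
    intro j hj
    simp at hj ⊢
    exact hf.reflect_lt hj
  · refine lt_of_lt_of_le h.2 (Finset.sum_le_sum_of_subset_of_nonneg ?_ fun _ _ _ => t.2.1 _)
    intro j hj
    simp at hj ⊢
    exact hf hj
end

theorem exists_isBlock {n : ℕ} (t : stdSimplex ℝ (Fin (n + 1))) (u : Set.Ico (0 : ℝ) 1) :
    ∃ i, IsBlock t u i := by
  by_contra! H
  simp only [isBlock_iff, not_and, not_lt] at H
  have key : ∀ i : Fin (n + 1), ∑ q with q ≤ i, t q ≤ u := by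
    intro i
    induction i using Fin.induction with
    | zero =>
      refine H 0 ?_
      simpa using u.2.1
    | succ i ih =>
      refine H i.succ (le_trans (le_of_eq ?_) ih)
      congr 1
      ext q
      simp [Fin.lt_def, Fin.le_def]
  have h1 := key (Fin.last n)
  have h2 : ∑ q with q ≤ Fin.last n, t q = 1 := by
    rw [Finset.filter_true_of_mem fun q _ => Fin.le_last q]
    exact t.2.2
  have := u.2.2
  linarith

/-- The block of `t` containing `u`. -/
noncomputable def block {n : ℕ} (t : stdSimplex ℝ (Fin (n + 1))) (u : Set.Ico (0 : ℝ) 1) :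
    Fin (n + 1) :=
  (exists_isBlock t u).choose

theorem isBlock_block {n : ℕ} (t : stdSimplex ℝ (Fin (n + 1))) (u : Set.Ico (0 : ℝ) 1) :
    IsBlock t u (block t u) := (exists_isBlock t u).choose_spec

theorem IsBlock.eq_block {n : ℕ} {t : stdSimplex ℝ (Fin (n + 1))} {u : Set.Ico (0 : ℝ) 1}
    {i : Fin (n + 1)} (h : IsBlock t u i) : i = block t u :=
  le_antisymm (not_lt.1 (h.not_block_lt t.2.1 (isBlock_block t u) le_rfl))
    (not_lt.1 ((isBlock_block t u).not_block_lt t.2.1 h le_rfl))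

theorem monotone_block {n : ℕ} (t : stdSimplex ℝ (Fin (n + 1))) : Monotone (block t) :=
  fun _ _ huv => not_lt.1 ((isBlock_block t _).not_block_lt t.2.1 (isBlock_block t _) huv)

theorem block_preimage {n : ℕ} (t : stdSimplex ℝ (Fin (n + 1))) (i : Fin (n + 1)) :
    block t ⁻¹' {i} = Subtype.val ⁻¹' Set.Ico (∑ q with q < i, t q) (∑ q with q ≤ i, t q) := by
  ext u
  constructor
  · rintro rfl
    exact isBlock_iff.1 (isBlock_block t u)
  · intro h
    refine (IsBlock.eq_block (isBlock_iff.2 ?_)).symm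
    exact h

theorem measurable_block {n : ℕ} (t : stdSimplex ℝ (Fin (n + 1))) : Measurable (block t) :=
  measurable_to_countable' fun i => by
    rw [block_preimage]
    exact measurable_subtype_coe measurableSet_Ico

theorem volume_block {n : ℕ} (t : stdSimplex ℝ (Fin (n + 1))) (i : Fin (n + 1)) :
    (volume.comap (Subtype.val : Set.Ico (0 : ℝ) 1 → ℝ)).real (block t ⁻¹' {i}) = t i := by
  rw [block_preimage]
  have hsub : Set.Ico (∑ q with q < i, t q) (∑ q with q ≤ i, t q) ⊆ Set.Ico (0 : ℝ) 1 := by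
    refine Set.Ico_subset_Ico (Finset.sum_nonneg fun _ _ => t.2.1 _) ?_
    rw [← t.2.2]
    exact Finset.sum_le_sum_of_subset_of_nonneg (Finset.subset_univ _) fun _ _ _ => t.2.1 _
  have e : (Finset.univ.filter fun q => q ≤ i) = insert i (Finset.univ.filter fun q => q < i) := by
    ext q
    simp [le_iff_eq_or_lt]
  have e2 : ∑ q with q ≤ i, t q = t i + ∑ q with q < i, t q := by
    rw [e, Finset.sum_insert (by simp)]
  rw [Measure.real, comap_subtype_coe_apply measurableSet_Ico,
    Subtype.image_preimage_coe, Set.inter_eq_right.2 hsub, Real.volume_Ico, ENNReal.toReal_ofReal]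
  · linarith
  · have := t.2.1 i
    change 0 ≤ t i at this
    linarith

/-- Finitely many weight vectors are pushforwards of a common one along monotone maps `α j`. The
blocks of the refinement are the fibres of `G`; surjectivity of `G` says that none is empty. -/
theorem exists_common_refinement {J : Type*} [Finite J] (n : J → ℕ)
    (t : ∀ j, stdSimplex ℝ (Fin (n j + 1))) :
    ∃ (N : ℕ) (t' : stdSimplex ℝ (Fin (N + 1))) (α : ∀ j, Fin (N + 1) →o Fin (n j + 1))
      (G : Set.Ico (0 : ℝ) 1 → Fin (N + 1)), Function.Surjective G ∧
      (∀ j u, α j (G u) = block (t j) u) ∧ ∀ j, stdSimplex.map (α j) t' = t j := by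
  classical
  have := Fintype.ofFinite J
  -- the sum of the block indices is monotone, and it jumps whenever one of the indices does
  let F : Set.Ico (0 : ℝ) 1 → ℕ := fun u => ∑ j, (block (t j) u : ℕ)
  have hFm : Monotone F := fun u v huv => Finset.sum_le_sum fun j _ => monotone_block (t j) huv
  have hFinj : ∀ u v, u ≤ v → F v ≤ F u → ∀ j, block (t j) u = block (t j) v := by
    intro u v huv h j
    have h1 := (Finset.sum_eq_sum_iff_of_le (fun j _ =>
      Fin.le_def.1 (monotone_block (t j) huv))).1 (le_antisymm (hFm huv) h)
    exact Fin.ext (h1 j (Finset.mem_univ j))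
  have hFmeas : Measurable F := Finset.measurable_sum _ fun j _ =>
    (measurable_of_countable (fun i : Fin (n j + 1) => (i : ℕ))).comp (measurable_block (t j))
  have hfin : (Set.range F).Finite := by
    refine (Set.finite_Iic (∑ j, n j)).subset ?_
    rintro _ ⟨u, rfl⟩
    exact Finset.sum_le_sum fun j _ => Nat.lt_succ_iff.1 (block (t j) u).2
  let S : Finset ℕ := hfin.toFinset
  have hne : 0 < S.card := Finset.card_pos.2 ⟨F ⟨0, by simp⟩, by simp [S]⟩
  obtain ⟨N, hN⟩ : ∃ N, S.card = N + 1 := ⟨S.card - 1, by omega⟩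
  let E : Fin (N + 1) ≃o S := S.orderIsoOfFin hN
  let G : Set.Ico (0 : ℝ) 1 → Fin (N + 1) := fun u => E.symm ⟨F u, by simp [S]⟩
  have hGsurj : Function.Surjective G := by
    intro i
    have h := (E i).2
    simp only [S, Set.Finite.mem_toFinset] at h
    obtain ⟨u, hu⟩ := h
    refine ⟨u, ?_⟩
    simp only [G, hu]
    exact E.symm_apply_apply i
  have hG : ∀ u v, G u ≤ G v ↔ F u ≤ F v := fun u v => by simp [G]
  have hGmeas : Measurable G := by
    refine measurable_to_countable' fun i => ?_
    have : G ⁻¹' {i} = F ⁻¹' {(E i : ℕ)} := by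
      ext u
      simp only [G, Set.mem_preimage, Set.mem_singleton_iff, OrderIso.symm_apply_eq,
        Subtype.ext_iff]
    rw [this]
    exact hFmeas (measurableSet_singleton _)
  have hαG : ∀ j u v, G u ≤ G v → block (t j) u ≤ block (t j) v := by
    intro j u v h
    rcases le_total u v with huv | huv
    · exact monotone_block _ huv
    · exact (hFinj v u huv ((hG _ _).1 h) j).ge
  choose σ hσ using hGsurj
  let α : ∀ j, Fin (N + 1) →o Fin (n j + 1) := fun j =>
    ⟨fun i => block (t j) (σ i), fun a b hab => hαG j _ _ (by rwa [hσ, hσ])⟩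
  have hα : ∀ j u, α j (G u) = block (t j) u := fun j u =>
    le_antisymm (hαG j _ _ (hσ _).le) (hαG j _ _ (hσ _).ge)
  -- the weights of the refinement are the lengths of the fibres of `G`
  have hvol : (volume.comap (Subtype.val : Set.Ico (0 : ℝ) 1 → ℝ)) Set.univ = 1 := by
    rw [comap_subtype_coe_apply measurableSet_Ico, Set.image_univ, Subtype.range_coe,
      Real.volume_Ico]
    simp
  have : IsProbabilityMeasure (volume.comap (Subtype.val : Set.Ico (0 : ℝ) 1 → ℝ)) := ⟨hvol⟩
  have hsum : ∀ s : Finset (Fin (N + 1)),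
      ∑ i ∈ s, (volume.comap (Subtype.val : Set.Ico (0 : ℝ) 1 → ℝ)).real (G ⁻¹' {i}) =
        (volume.comap (Subtype.val : Set.Ico (0 : ℝ) 1 → ℝ)).real (G ⁻¹' s) := fun s =>
    sum_measureReal_preimage_singleton s fun i _ => hGmeas (measurableSet_singleton i)
  refine ⟨N, ⟨fun i => (volume.comap (Subtype.val : Set.Ico (0 : ℝ) 1 → ℝ)).real (G ⁻¹' {i}),
    fun i => measureReal_nonneg, ?_⟩, α, G, fun i => ⟨σ i, hσ i⟩, hα, fun j => ?_⟩
  · rw [hsum]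
    simp
  · ext i
    rw [stdSimplex.map_coe, FunOnFinite.linearMap_apply_apply]
    refine (hsum _).trans ((congrArg _ ?_).trans (volume_block (t j) i))
    ext u
    simp [← hα]

/-! ### Barycentric coordinates on the nerve of a finite poset -/

section
variable {P Q : Type} [PartialOrder P] [PartialOrder Q]

/-- The simplex of the nerve given by a monotone sequence. -/
def chain {n : ℕ} (s : Fin (n + 1) →o P) : (nerve P) _⦋n⦌ := s.monotone.functor

theorem nerve_ext {n : ℕ} {s s' : (nerve P) _⦋n⦌} (h : ∀ i, s.obj i = s'.obj i) : s = s' :=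
  CategoryTheory.Functor.ext h fun _ _ _ => Subsingleton.elim _ _

theorem nerve_obj_congr {n : ℕ} {s s' : (nerve P) _⦋n⦌} (h : s = s') (i : Fin (n + 1)) :
    s.obj i = s'.obj i := by rw [h]

theorem nerve_monotone {n : ℕ} (s : (nerve P) _⦋n⦌) : Monotone s.obj :=
  fun _ _ h => leOfHom (s.map (homOfLE h))

theorem exists_weights (P : Type) [PartialOrder P] [Fintype P] :
    ∃ W : C(SSet.toTop.obj (nerve P), stdSimplex ℝ P), ∀ (n : ℕ) (s : (nerve P) _⦋n⦌) t,
      W (cell s t) = stdSimplex.map s.obj t :=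
  exists_desc (X := nerve P)
    (fun n (s : (nerve P) _⦋n⦌) => ⟨stdSimplex.map s.obj, stdSimplex.continuous_map s.obj⟩)
    fun _ m f (s : (nerve P) _⦋m⦌) t => (stdSimplex.map_comp_apply f s.obj t).symm

/-- The barycentric coordinates of a point in the realization of the nerve of a finite poset. -/
noncomputable def weights (P : Type) [PartialOrder P] [Fintype P] :
    C(SSet.toTop.obj (nerve P), stdSimplex ℝ P) := (exists_weights P).choose

theorem weights_cell [Fintype P] {n : ℕ} (s : (nerve P) _⦋n⦌) (t : stdSimplex ℝ (Fin (n + 1))) :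
    weights P (cell s t) = stdSimplex.map s.obj t := (exists_weights P).choose_spec n s t

theorem stdSimplex_map_apply {α β : Type*} [Fintype α] [Fintype β] [DecidableEq β] (f : α → β)
    (t : stdSimplex ℝ α) (b : β) : stdSimplex.map f t b = ∑ a with f a = b, t a := by
  rw [stdSimplex.map_coe, FunOnFinite.linearMap_apply_apply]

theorem weights_realize [Fintype P] [Fintype Q] {F : nerve P ⟶ nerve Q} {f : P → Q}
    (hF : ∀ (n : ℕ) (s : (nerve P) _⦋n⦌) (i : Fin (n + 1)), (F.app _ s).obj i = f (s.obj i))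
    (x : SSet.toTop.obj (nerve P)) :
    weights Q (realize F x) = stdSimplex.map f (weights P x) := by
  obtain ⟨n, s, t, rfl⟩ := exists_cell x
  rw [realize_cell, weights_cell, weights_cell, stdSimplex.map_comp_apply]
  congr 1
  exact funext (hF n s)

/-- The member of a chain whose block contains `u` is determined by the barycentric coordinates on
the poset: two candidates have positive weight, hence both lie in the first chain and are
comparable. -/
theorem obj_block_eq_of_map_eq [Fintype P] {n m : ℕ} {s : (nerve P) _⦋n⦌} {s' : (nerve P) _⦋m⦌}
    {t : stdSimplex ℝ (Fin (n + 1))} {t' : stdSimplex ℝ (Fin (m + 1))}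
    (h : stdSimplex.map s.obj t = stdSimplex.map s'.obj t') (u : Set.Ico (0 : ℝ) 1) :
    s.obj (block t u) = s'.obj (block t' u) := by
  classical
  have h1 : IsBlock (stdSimplex.map s.obj t) u (s.obj (block t u)) :=
    IsBlock.map (nerve_monotone s) (isBlock_block t u)
  have h2 : IsBlock (stdSimplex.map s.obj t) u (s'.obj (block t' u)) := by
    rw [h]
    exact IsBlock.map (nerve_monotone s') (isBlock_block t' u)
  have hmem : ∀ p, 0 < stdSimplex.map s.obj t p → ∃ i, s.obj i = p := by
    intro p hp
    rw [stdSimplex_map_apply] at hp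
    obtain ⟨i, hi, -⟩ := Finset.exists_ne_zero_of_sum_ne_zero hp.ne'
    exact ⟨i, by simpa using hi⟩
  obtain ⟨i, hi⟩ := hmem _ h2.pos
  have hcomp : s.obj (block t u) ≤ s'.obj (block t' u) ∨
      s'.obj (block t' u) ≤ s.obj (block t u) := by
    rw [← hi]
    exact (le_total (block t u) i).imp (fun h => nerve_monotone s h) fun h => nerve_monotone s h
  have hnn := (stdSimplex.map s.obj t).2.1
  rcases hcomp with h | h
  · exact h.eq_or_lt.resolve_right (h2.not_block_lt hnn h1 le_rfl)
  · exact (h.eq_or_lt.resolve_right (h1.not_block_lt hnn h2 le_rfl)).symm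
end

/-- The morphism of `SimplexCategory` given by a monotone map. -/
abbrev simplexHom {n m : ℕ} (α : Fin (n + 1) →o Fin (m + 1)) : ⦋n⦌ ⟶ ⦋m⦌ :=
  SimplexCategory.mkHom α

/-- Two weight vectors have a common refinement on which simplices with equal barycentric
coordinates agree. -/
theorem exists_refinement_pair {n m : ℕ} (t : stdSimplex ℝ (Fin (n + 1)))
    (t' : stdSimplex ℝ (Fin (m + 1))) :
    ∃ (N : ℕ) (r : stdSimplex ℝ (Fin (N + 1))) (α : Fin (N + 1) →o Fin (n + 1))
      (β : Fin (N + 1) →o Fin (m + 1)), stdSimplex.map α r = t ∧ stdSimplex.map β r = t' ∧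
      ∀ (X : SSet.{0}) (P : Type) [PartialOrder P] [Fintype P] (f : X ⟶ nerve P) (s : X _⦋n⦌)
        (s' : X _⦋m⦌), weights P (realize f (cell s t)) = weights P (realize f (cell s' t')) →
        f.app _ (X.map (simplexHom α).op s) = f.app _ (X.map (simplexHom β).op s') := by
  obtain ⟨N, r, α, G, hG, hα, hr⟩ := exists_common_refinement (J := Bool)
    (fun b => bif b then m else n)
    (Bool.rec (motive := fun b => stdSimplex ℝ (Fin ((bif b then m else n) + 1))) t t')
  refine ⟨N, r, α false, α true, hr false, hr true, fun X P _ _ f s s' hj => ?_⟩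
  rw [realize_cell, realize_cell, weights_cell, weights_cell] at hj
  refine nerve_ext fun i => ?_
  obtain ⟨u, rfl⟩ := hG i
  have e0 := ConcreteCategory.congr_hom (f.naturality (simplexHom (α false)).op) s
  have e1 := ConcreteCategory.congr_hom (f.naturality (simplexHom (α true)).op) s'
  refine (nerve_obj_congr e0 (G u)).trans (Eq.trans ?_ (nerve_obj_congr e1 (G u)).symm)
  have h2 : α false (G u) = block t u := hα false u
  have h3 : α true (G u) = block t' u := hα true u
  change (f.app _ s).obj (α false (G u)) = (f.app _ s').obj (α true (G u))
  rw [h2, h3]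
  exact obj_block_eq_of_map_eq hj u

/-- If maps to nerves of finite posets separate the simplices of `X`, then the barycentric
coordinates of the images separate the points of `|X|`. -/
theorem eq_of_weights_eq {X : SSet.{0}} {J : Type*} {P : J → Type} [∀ j, PartialOrder (P j)]
    [∀ j, Fintype (P j)] (f : ∀ j, X ⟶ nerve (P j))
    (hf : ∀ (n : ℕ) (s s' : X _⦋n⦌), (∀ j, (f j).app _ s = (f j).app _ s') → s = s')
    {x y : SSet.toTop.obj X}
    (h : ∀ j, weights (P j) (realize (f j) x) = weights (P j) (realize (f j) y)) : x = y := by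
  obtain ⟨n, s, t, rfl⟩ := exists_cell x
  obtain ⟨m, s', t', rfl⟩ := exists_cell y
  obtain ⟨N, r, α, β, h0, h1, key⟩ := exists_refinement_pair t t'
  have e := hf _ _ _ fun j => key X (P j) (f j) s s' (h j)
  have h0' : stdSimplex.map (simplexHom α) r = t := h0
  have h1' : stdSimplex.map (simplexHom β) r = t' := h1
  rw [← h0', ← h1', ← cell_map, ← cell_map, e]

/-- A finite family of points in realizations lies in simplices of a common dimension, with common
coordinates. -/
theorem exists_common_cell {J : Type*} [Finite J] {X : J → SSet.{0}}
    (x : ∀ j, SSet.toTop.obj (X j)) :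
    ∃ (N : ℕ) (s : ∀ j, (X j) _⦋N⦌) (t : stdSimplex ℝ (Fin (N + 1))), ∀ j, cell (s j) t = x j := by
  choose n s t h using fun j => exists_cell (x j)
  obtain ⟨N, r, α, G, -, -, hr⟩ := exists_common_refinement n t
  refine ⟨N, fun j => (X j).map (simplexHom (α j)).op (s j), r, fun j => ?_⟩
  rw [cell_map]
  exact (congrArg (cell (s j)) (hr j)).trans (h j)

instance {P : Type} [PartialOrder P] [Finite P] (n : ℕ) : Finite ((nerve P) _⦋n⦌) :=
  Finite.of_injective (fun s => (s.obj : Fin (n + 1) → P)) fun _ _ h => nerve_ext (congrFun h)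

instance {P : Type} [PartialOrder P] [Finite P] : (nerve P).Finite := by
  have : (nerve P).HasDimensionLT (Nat.card P) := ⟨fun n hn => by
    rw [Set.top_eq_univ, Set.eq_univ_iff_forall]
    intro s
    by_contra hs
    have h := (PartialOrder.mem_nerve_nonDegenerate_iff_injective s).1 hs
    have := Nat.card_le_card_of_injective _ h
    simp at this
    omega⟩
  exact SSet.finite_of_hasDimensionLT _ (Nat.card P) fun i _ => inferInstance

/-- The realization of a finite simplicial set is covered by finitely many nondegenerate cells. -/
theorem compactSpace_realization (X : SSet.{0}) [X.Finite] : CompactSpace (SSet.toTop.obj X) := by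
  refine ⟨?_⟩
  have h : (Set.univ : Set (SSet.toTop.obj X)) =
      ⋃ s : X.N, Set.range (cell (X := X) (n := s.dim) s.simplex) := by
    refine (Set.eq_univ_of_forall fun x => ?_).symm
    obtain ⟨n, s, t, rfl⟩ := exists_cell x
    obtain ⟨m, f, -, y, rfl⟩ := X.exists_nonDegenerate s
    rw [Set.mem_iUnion]
    refine ⟨SSet.N.mk y.1 y.2, stdSimplex.map f t, ?_⟩
    rw [cell_map]
    rfl
  rw [h]
  exact isCompact_iUnion fun s => isCompact_range (cell s.simplex).continuous

/-- The realization of a simplicial subset of the nerve of a finite poset is Hausdorff: it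
injects continuously into a simplex. -/
theorem t2Space_realization {X : SSet.{0}} {P : Type} [PartialOrder P] [Finite P]
    (i : X ⟶ nerve P) (hi : ∀ (n : ℕ) (s s' : X _⦋n⦌), i.app _ s = i.app _ s' → s = s') :
    T2Space (SSet.toTop.obj X) := by
  have := Fintype.ofFinite P
  refine T2Space.of_injective_continuous (f := fun x => weights P (realize i x)) ?_
    ((weights P).continuous.comp (realize i).continuous)
  intro x y h
  exact eq_of_weights_eq (J := Unit) (fun _ => i) (fun n s s' h => hi n s s' (h ()))
    fun _ => h

/-! ### Powers of nerves -/

open scoped MonoidalCategory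

theorem realize_comp {X Y Z : SSet.{0}} (f : X ⟶ Y) (g : Y ⟶ Z) (x : SSet.toTop.obj X) :
    realize (f ≫ g) x = realize g (realize f x) := by
  change (SSet.toTop.map (f ≫ g)) x = _
  rw [Functor.map_comp]
  rfl

theorem realize_id {X : SSet.{0}} (x : SSet.toTop.obj X) : realize (𝟙 X) x = x := by
  change (SSet.toTop.map (𝟙 X)) x = _
  rw [CategoryTheory.Functor.map_id]
  rfl

/-- The nerve of a poset; unlike `nerve`, it never refers to the product category structure on
types of functions. -/
abbrev orderNerve (P : Type) [PartialOrder P] : SSet.{0} :=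
  @nerve P (Preorder.smallCategory P)

/-- The comparison of a power of a nerve with the nerve of the power of the poset. -/
def spowNerve (P : Type) [PartialOrder P] (n : ℕ) :
    spow (nerve P) n ⟶ orderNerve (Fin n → P) where
  app U := TypeCat.ofHom fun (σ : Fin n → (nerve P).obj U) =>
    (show (orderNerve (Fin n → P)).obj U from
      @Monotone.functor (Fin (U.unop.len + 1)) (Fin n → P) _ _ (f := fun a i => (σ i).obj a)
        (fun _ _ hab i => leOfHom ((σ i).map (homOfLE hab))))
  naturality _ _ _ := rfl

theorem spowNerve_injective (P : Type) [PartialOrder P] (n : ℕ) (U : SimplexCategoryᵒᵖ) :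
    Function.Injective ((spowNerve P n).app U) := by
  intro s s' h
  refine funext fun i => CategoryTheory.Functor.ext (fun a => ?_) fun _ _ _ => Subsingleton.elim _ _
  exact congrFun (nerve_obj_congr (P := Fin n → P) (n := U.unop.len) h a) i

instance spow_finite (P : Type) [PartialOrder P] [Finite P] (n : ℕ) :
    (spow (nerve P) n).Finite := by
  have : Mono (spowNerve P n) := by
    have (U : SimplexCategoryᵒᵖ) : Mono ((spowNerve P n).app U) :=
      (mono_iff_injective _).2 (spowNerve_injective P n U)
    exact NatTrans.mono_of_mono_app _
  exact SSet.finite_of_mono (spowNerve P n)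

/-- A common refinement gives surjectivity, and separation of points by weights injectivity. -/
theorem bijective_spowProj (P : Type) [PartialOrder P] [Finite P] (n : ℕ) :
    Function.Bijective fun (x : SSet.toTop.obj (spow (nerve P) n)) (i : Fin n) =>
      realize (spowProj (nerve P) n i) x := by
  have := Fintype.ofFinite P
  constructor
  · intro x y h
    exact eq_of_weights_eq (fun i => spowProj (nerve P) n i) (fun _ _ _ h => funext h)
      fun i => congrArg (weights P) (congrFun h i)
  · intro y
    obtain ⟨N, s, t, h⟩ := exists_common_cell y
    refine ⟨cell (X := spow (nerve P) n) (n := N) s t, funext fun i => ?_⟩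
    rw [← h i]
    exact realize_cell _ _ _

/-- The realization of a power of the nerve of a finite poset is the power of its realization. -/
noncomputable def spowHomeo (P : Type) [PartialOrder P] [Finite P] (n : ℕ) :
    SSet.toTop.obj (spow (nerve P) n) ≃ₜ (Fin n → SSet.toTop.obj (nerve P)) :=
  have := compactSpace_realization (spow (nerve P) n)
  have : T2Space (SSet.toTop.obj (nerve P)) := t2Space_realization (𝟙 _) fun _ _ _ h => h
  Continuous.homeoOfEquivCompactToT2 (f := Equiv.ofBijective _ (bijective_spowProj P n))
    (continuous_pi fun i => (realize (spowProj (nerve P) n i)).continuous)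

/-! ### Order homotopies -/

/-- The cylinder over a simplicial set, with the nerve of `{0 < 1}` as interval. -/
abbrev cylinder (X : SSet.{0}) : SSet.{0} := X ⊗ nerve (Fin 2)

/-- The projection of the cylinder to its base. -/
abbrev cylinderFst (X : SSet.{0}) : cylinder X ⟶ X := SemiCartesianMonoidalCategory.fst _ _

/-- The projection of the cylinder to the interval. -/
abbrev cylinderSnd (X : SSet.{0}) : cylinder X ⟶ nerve (Fin 2) :=
  SemiCartesianMonoidalCategory.snd _ _

theorem bijective_cylinder {X : SSet.{0}} {P : Type} [PartialOrder P] [Finite P]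
    (i : X ⟶ nerve P) (hi : ∀ (n : ℕ) (s s' : X _⦋n⦌), i.app _ s = i.app _ s' → s = s') :
    Function.Bijective fun x : SSet.toTop.obj (cylinder X) =>
      (realize (cylinderFst X) x, weights (Fin 2) (realize (cylinderSnd X) x)) := by
  have := Fintype.ofFinite P
  constructor
  · intro x y h
    obtain ⟨n, s, t, rfl⟩ := exists_cell x
    obtain ⟨m, s', t', rfl⟩ := exists_cell y
    obtain ⟨N, r, α, β, h0, h1, key⟩ := exists_refinement_pair t t'
    have e1 := key (cylinder X) P (cylinderFst X ≫ i) s s' (by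
      rw [realize_comp, realize_comp]
      exact congrArg (fun z => weights P (realize i z)) (congrArg Prod.fst h))
    have e2 := key (cylinder X) (Fin 2) (cylinderSnd X) s s' (congrArg Prod.snd h)
    have e : (cylinder X).map (simplexHom α).op s = (cylinder X).map (simplexHom β).op s' :=
      Prod.ext (hi _ _ _ e1) e2
    have h0' : stdSimplex.map (simplexHom α) r = t := h0
    have h1' : stdSimplex.map (simplexHom β) r = t' := h1
    rw [← h0', ← h1', ← cell_map, ← cell_map, e]
  · rintro ⟨x, τ⟩
    let y : SSet.toTop.obj (nerve (Fin 2)) := cell (n := 1) (chain OrderHom.id) τ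
    obtain ⟨N, s, t, h⟩ := exists_common_cell
      (X := Bool.rec X (nerve (Fin 2))) (Bool.rec x y)
    refine ⟨cell (X := cylinder X) (n := N) (s false, s true) t, ?_⟩
    refine Prod.ext ?_ ?_
    · exact (realize_cell _ _ _).trans (h false)
    · refine (congrArg (weights (Fin 2)) ((realize_cell _ _ _).trans (h true))).trans ?_
      change weights (Fin 2) y = τ
      rw [weights_cell]
      exact stdSimplex.map_id_apply τ

/-- The realization of the cylinder is the product of the realization with a segment. -/
noncomputable def cylinderHomeo {X : SSet.{0}} [X.Finite] {P : Type} [PartialOrder P] [Finite P]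
    (i : X ⟶ nerve P) (hi : ∀ (n : ℕ) (s s' : X _⦋n⦌), i.app _ s = i.app _ s' → s = s') :
    SSet.toTop.obj (cylinder X) ≃ₜ SSet.toTop.obj X × stdSimplex ℝ (Fin 2) :=
  have := compactSpace_realization (cylinder X)
  have := t2Space_realization i hi
  Continuous.homeoOfEquivCompactToT2 (f := Equiv.ofBijective _ (bijective_cylinder i hi))
    ((realize (cylinderFst X)).continuous.prodMk
      ((weights (Fin 2)).continuous.comp (realize (cylinderSnd X)).continuous))

theorem cylinderHomeo_apply {X : SSet.{0}} [X.Finite] {P : Type} [PartialOrder P] [Finite P]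
    (i : X ⟶ nerve P) (hi : ∀ (n : ℕ) (s s' : X _⦋n⦌), i.app _ s = i.app _ s' → s = s')
    (x : SSet.toTop.obj (cylinder X)) : cylinderHomeo i hi x =
      (realize (cylinderFst X) x, weights (Fin 2) (realize (cylinderSnd X) x)) := rfl

/-- The inclusion of the base at the end `ε` of the cylinder. -/
def cylinderIncl (X : SSet.{0}) (ε : Fin 2) : X ⟶ cylinder X where
  app U := TypeCat.ofHom fun s => (s, chain (n := U.unop.len) (OrderHom.const _ ε))

theorem cylinderHomeo_incl {X : SSet.{0}} [X.Finite] {P : Type} [PartialOrder P] [Finite P]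
    (i : X ⟶ nerve P) (hi : ∀ (n : ℕ) (s s' : X _⦋n⦌), i.app _ s = i.app _ s' → s = s')
    (ε : Fin 2) (x : SSet.toTop.obj X) :
    cylinderHomeo i hi (realize (cylinderIncl X ε) x) = (x, stdSimplex.vertex ε) := by
  rw [cylinderHomeo_apply]
  refine Prod.ext ?_ ?_
  · rw [← realize_comp]
    exact realize_id x
  · obtain ⟨n, s, t, rfl⟩ := exists_cell x
    refine (congrArg (weights (Fin 2)) ((congrArg (realize (cylinderSnd X))
      (realize_cell _ _ _)).trans (realize_cell _ _ _))).trans ?_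
    change weights (Fin 2) (cell (n := n) (chain (OrderHom.const _ ε)) t) = stdSimplex.vertex ε
    rw [weights_cell]
    ext j
    rw [stdSimplex_map_apply]
    change ∑ a with ε = j, t a = (Pi.single ε (1 : ℝ) : Fin 2 → ℝ) j
    rcases eq_or_ne ε j with rfl | hj
    · have h : ∑ a, t a = 1 := t.2.2
      simp [h]
    · simp [hj, hj.symm]

section
variable {X : SSet.{0}} {R : Type} [PartialOrder R] (A B : X ⟶ nerve R)
  (hAB : ∀ (U : SimplexCategoryᵒᵖ) (s : X.obj U) k,
    CategoryTheory.Functor.obj (A.app U s) k ≤ CategoryTheory.Functor.obj (B.app U s) k)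

/-- The map on the cylinder that is `A` over `0` and `B` over `1`. -/
def orderHomotopy : cylinder X ⟶ nerve R where
  app U := TypeCat.ofHom fun (s : X.obj U × (nerve (Fin 2)).obj U) =>
    (show (nerve R).obj U from
      Monotone.functor (f := fun a =>
          if s.2.obj a = 0 then CategoryTheory.Functor.obj (A.app U s.1) a
          else CategoryTheory.Functor.obj (B.app U s.1) a) (by
        intro a b hab
        have hA := leOfHom (CategoryTheory.Functor.map (A.app U s.1) (homOfLE hab))
        have hB := leOfHom (CategoryTheory.Functor.map (B.app U s.1) (homOfLE hab))
        have h2 : s.2.obj a ≤ s.2.obj b := leOfHom (s.2.map (homOfLE hab))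
        dsimp only
        split_ifs with h h' h'
        · exact hA
        · exact hA.trans (hAB _ _ _)
        · rw [h'] at h2
          exact absurd (le_antisymm h2 (Fin.zero_le _)) h
        · exact hB))
  naturality U V α := by
    refine ConcreteCategory.hom_ext _ _ fun (s : X.obj U × (nerve (Fin 2)).obj U) => ?_
    refine nerve_ext (n := V.unop.len) fun a => ?_
    have hA := ConcreteCategory.congr_hom (A.naturality α) s.1
    have hB := ConcreteCategory.congr_hom (B.naturality α) s.1
    change (if _ then CategoryTheory.Functor.obj (A.app V (X.map α s.1)) a
          else CategoryTheory.Functor.obj (B.app V (X.map α s.1)) a) = _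
    rw [show A.app V (X.map α s.1) = _ from hA, show B.app V (X.map α s.1) = _ from hB]
    rfl

theorem cylinderIncl_zero_orderHomotopy : cylinderIncl X 0 ≫ orderHomotopy A B hAB = A := by
  refine NatTrans.ext (funext fun U => ConcreteCategory.hom_ext _ _ fun s => ?_)
  refine nerve_ext (n := U.unop.len) fun a => ?_
  change (if (0 : Fin 2) = 0 then CategoryTheory.Functor.obj (A.app U s) a
    else CategoryTheory.Functor.obj (B.app U s) a) = _
  exact if_pos rfl

theorem cylinderIncl_one_orderHomotopy : cylinderIncl X 1 ≫ orderHomotopy A B hAB = B := by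
  refine NatTrans.ext (funext fun U => ConcreteCategory.hom_ext _ _ fun s => ?_)
  refine nerve_ext (n := U.unop.len) fun a => ?_
  change (if (1 : Fin 2) = 0 then CategoryTheory.Functor.obj (A.app U s) a
    else CategoryTheory.Functor.obj (B.app U s) a) = _
  exact if_neg (by decide : (1 : Fin 2) ≠ 0)

end

/-- The self-map of the cylinder induced by one of the base. -/
def cylinderMap {X : SSet.{0}} (ν : X ⟶ X) : cylinder X ⟶ cylinder X where
  app U := TypeCat.ofHom fun (s : X.obj U × (nerve (Fin 2)).obj U) => (ν.app U s.1, s.2)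
  naturality U V α := by
    refine ConcreteCategory.hom_ext _ _ fun (s : X.obj U × (nerve (Fin 2)).obj U) => ?_
    exact Prod.ext (show ν.app V (X.map α s.1) = X.map α (ν.app U s.1) from
      ConcreteCategory.congr_hom (ν.naturality α) s.1) rfl

theorem realize_equivariant {X Y : Z2SSet} (g : Z2SSet.Map X Y) (x : X.realization) :
    realize g.1 (X.realization.inv x) = Y.realization.inv (realize g.1 x) :=
  (realize_comp X.inv g.1 x).symm.trans
    ((congrArg (fun f => realize f x) g.2).trans (realize_comp g.1 Y.inv x))

/-- The realization of an equivariant simplicial map. -/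
noncomputable def realizeMap {X Y : Z2SSet} (g : Z2SSet.Map X Y) :
    Z2Space.Map X.realization Y.realization :=
  ⟨realize g.1, realize_equivariant g⟩

/-- Equivariant simplicial maps to an order complex that are comparable vertex by vertex are
equivariantly homotopic after realization. -/
theorem homotopicWith_of_le {X : Z2SSet} [X.sset.Finite] {P : Type} [PartialOrder P] [Finite P]
    (i : X.sset ⟶ nerve P) (hi : ∀ (n : ℕ) (s s' : X.sset _⦋n⦌), i.app _ s = i.app _ s' → s = s')
    {R : Type} [PartialOrder R] {ν : R →o R} {hν : ∀ x, ν (ν x) = x}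
    (A B : Z2SSet.Map X (orderComplex R ν hν))
    (hAB : ∀ (U : SimplexCategoryᵒᵖ) (s : X.sset.obj U) k,
      CategoryTheory.Functor.obj (A.1.app U s) k ≤ CategoryTheory.Functor.obj (B.1.app U s) k) :
    ContinuousMap.HomotopicWith (realizeMap A).1 (realizeMap B).1 Z2Space.IsEquivariant := by
  let K := orderHomotopy (R := R) A.1 B.1 hAB
  have hK : cylinderMap X.inv ≫ K = K ≫ (orderComplex R ν hν).inv := by
    refine NatTrans.ext (funext fun U => ConcreteCategory.hom_ext _ _
      fun (s : X.sset.obj U × (nerve (Fin 2)).obj U) => ?_)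
    have hA := ConcreteCategory.congr_hom (NatTrans.congr_app A.2 U) s.1
    have hB := ConcreteCategory.congr_hom (NatTrans.congr_app B.2 U) s.1
    refine nerve_ext (n := U.unop.len) fun a => ?_
    change (if s.2.obj a = 0 then CategoryTheory.Functor.obj (A.1.app U (X.inv.app U s.1)) a
          else CategoryTheory.Functor.obj (B.1.app U (X.inv.app U s.1)) a) =
      ν (if s.2.obj a = 0 then CategoryTheory.Functor.obj (A.1.app U s.1) a
          else CategoryTheory.Functor.obj (B.1.app U s.1) a)
    rw [show A.1.app U (X.inv.app U s.1) = _ from hA, show B.1.app U (X.inv.app U s.1) = _ from hB]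
    split_ifs <;> rfl
  let C := cylinderHomeo i hi
  have hC : ∀ x τ, C.symm (realize X.inv x, τ) = realize (cylinderMap X.inv) (C.symm (x, τ)) := by
    intro x τ
    obtain ⟨y, hy⟩ := C.surjective (x, τ)
    rw [← hy, Homeomorph.symm_apply_apply, Homeomorph.symm_apply_eq, cylinderHomeo_apply,
      ← realize_comp, ← realize_comp]
    have h : C y = (realize (cylinderFst X.sset) y,
        weights (Fin 2) (realize (cylinderSnd X.sset) y)) :=
      cylinderHomeo_apply i hi y
    rw [hy, Prod.ext_iff] at h
    refine Prod.ext ?_ h.2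
    change realize X.inv x = realize (cylinderFst X.sset ≫ X.inv) y
    rw [realize_comp]
    exact congrArg (realize X.inv) h.1
  have hI : ∀ ε x, C.symm (x, stdSimplex.vertex ε) = realize (cylinderIncl X.sset ε) x := by
    intro ε x
    rw [Homeomorph.symm_apply_eq]
    exact (cylinderHomeo_incl i hi ε x).symm
  refine ⟨{ toFun := fun p => realize K (C.symm (p.2, stdSimplexHomeomorphUnitInterval.symm p.1))
            continuous_toFun := by
              refine (realize K).continuous.comp (C.symm.continuous.comp ?_)
              exact continuous_snd.prodMk
                (stdSimplexHomeomorphUnitInterval.symm.continuous.comp continuous_fst)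
            map_zero_left := fun x => ?_
            map_one_left := fun x => ?_
            prop' := fun τ x => ?_ }⟩
  · have h : stdSimplexHomeomorphUnitInterval.symm 0 = stdSimplex.vertex 0 := by
      rw [Homeomorph.symm_apply_eq, stdSimplexHomeomorphUnitInterval_zero]
    refine (congrArg (realize K) ((congrArg (fun τ => C.symm (x, τ)) h).trans (hI 0 x))).trans ?_
    refine (realize_comp _ _ x).symm.trans ?_
    exact congrArg (fun f => realize f x) (cylinderIncl_zero_orderHomotopy A.1 B.1 hAB)
  · have h : stdSimplexHomeomorphUnitInterval.symm 1 = stdSimplex.vertex 1 := by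
      rw [Homeomorph.symm_apply_eq, stdSimplexHomeomorphUnitInterval_one]
    refine (congrArg (realize K) ((congrArg (fun τ => C.symm (x, τ)) h).trans (hI 1 x))).trans ?_
    refine (realize_comp _ _ x).symm.trans ?_
    exact congrArg (fun f => realize f x) (cylinderIncl_one_orderHomotopy A.1 B.1 hAB)
  · refine (congrArg (realize K) (hC x _)).trans ?_
    refine (realize_comp _ _ _).symm.trans ?_
    exact (congrArg (fun f => realize f _) hK).trans (realize_comp _ _ _)

/-! ### Tent functions on the circle -/

section
variable {L : ℕ}

/-- The residues modulo `L` as the integer points of a circle of circumference `L`. -/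
noncomputable def GammaVertex.pos (p : GammaVertex L) : AddCircle (L : ℝ) := ((p.val.val : ℝ) :)

theorem coe_period_mul_intCast (m : ℤ) : (((L : ℝ) * m : ℝ) : AddCircle (L : ℝ)) = 0 :=
  (AddCircle.coe_eq_zero_iff _).2 ⟨m, by rw [zsmul_eq_mul]; ring⟩

theorem GammaVertex.pos_intCast [NeZero L] (m : ℤ) :
    GammaVertex.pos (L := L) ⟨(m : ZMod L)⟩ = ((m : ℝ) : AddCircle (L : ℝ)) := by
  have h : (((m : ZMod L).val : ℤ) : ℝ) = m - L * ((m / L : ℤ) : ℝ) := by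
    rw [ZMod.val_intCast, Int.emod_def]
    push_cast
    ring
  have h' : (((m : ZMod L).val : ℝ)) = m - L * ((m / L : ℤ) : ℝ) := by exact_mod_cast h
  unfold GammaVertex.pos
  rw [h', AddCircle.coe_sub, coe_period_mul_intCast, sub_zero]

theorem GammaVertex.exists_int [NeZero L] (p : GammaVertex L) : ∃ m : ℤ, p = ⟨(m : ZMod L)⟩ :=
  ⟨p.val.val, GammaVertex.ext' (by simp)⟩

instance [NeZero L] : Finite (GammaVertex L) :=
  Finite.of_injective GammaVertex.val fun _ _ h => GammaVertex.ext' h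

/-- The tent function of height one around the vertex `p` on a circle of circumference `L`. -/
noncomputable def tent (θ : AddCircle (L : ℝ)) (p : GammaVertex L) : ℝ := max 0 (1 - ‖θ - p.pos‖)

theorem continuous_tent (p : GammaVertex L) : Continuous fun θ => tent θ p := by
  unfold tent
  fun_prop

open Classical in
/-- A point between the consecutive vertices `k` and `k + 1` meets only their two tents. -/
theorem tent_add [NeZero L] (hL : 3 ≤ L) (k : ℤ) {r : ℝ} (h0 : 0 ≤ r) (h1 : r ≤ 1)
    (p : GammaVertex L) : tent (((k : ℝ) + r : ℝ) : AddCircle (L : ℝ)) p =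
      (if ⟨(k : ZMod L)⟩ = p then 1 - r else 0) +
        (if ⟨((k + 1 : ℤ) : ZMod L)⟩ = p then r else 0) := by
  obtain ⟨m, rfl⟩ := p.exists_int
  have hL' : (3 : ℝ) ≤ L := by exact_mod_cast hL
  have key : ∀ a : ℤ, (⟨(a : ZMod L)⟩ : GammaVertex L) = ⟨(m : ZMod L)⟩ ↔
      ∃ n : ℤ, a = m + L * n := by
    intro a
    rw [GammaVertex.mk.injEq, ZMod.intCast_eq_intCast_iff_dvd_sub]
    constructor
    · rintro ⟨c, hc⟩; exact ⟨-c, by linarith⟩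
    · rintro ⟨c, hc⟩; exact ⟨-c, by linarith⟩
  have hne : ¬ ((∃ n : ℤ, k = m + L * n) ∧ ∃ n : ℤ, k + 1 = m + L * n) := by
    rintro ⟨⟨a, ha⟩, b, hb⟩
    have h : (L : ℤ) * (b - a) = 1 := by linarith
    have := Int.le_of_dvd one_pos ⟨_, h.symm⟩
    omega
  rw [tent, GammaVertex.pos_intCast, ← AddCircle.coe_sub, key, key]
  by_cases hk : ∃ n : ℤ, k = m + L * n
  · rw [if_pos hk, if_neg fun h => hne ⟨hk, h⟩]
    obtain ⟨n, rfl⟩ := hk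
    have e : ((m + L * n : ℤ) : ℝ) + r - m = r + L * n := by push_cast; ring
    rw [e, AddCircle.coe_add, coe_period_mul_intCast, add_zero,
      (AddCircle.norm_coe_eq_abs_iff (L : ℝ) (x := r) (by positivity)).2, abs_of_nonneg h0,
      max_eq_right (by linarith)]
    · ring
    · rw [abs_of_nonneg h0, abs_of_pos (by linarith)]; linarith
  · rw [if_neg hk]
    by_cases hk1 : ∃ n : ℤ, k + 1 = m + L * n
    · rw [if_pos hk1]
      obtain ⟨n, hn⟩ := hk1
      have e : (k : ℝ) + r - m = (r - 1) + L * n := by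
        have : (k : ℝ) + 1 = m + L * n := by exact_mod_cast hn
        linarith
      rw [e, AddCircle.coe_add, coe_period_mul_intCast, add_zero,
        (AddCircle.norm_coe_eq_abs_iff (L : ℝ) (x := r - 1) (by positivity)).2,
        abs_of_nonpos (by linarith), max_eq_right (by linarith)]
      · ring
      · rw [abs_of_nonpos (by linarith), abs_of_pos (by linarith)]; linarith
    · rw [if_neg hk1, max_eq_left, add_zero]
      rw [AddCircle.norm_eq, sub_nonpos]
      generalize round ((L : ℝ)⁻¹ * ((k : ℝ) + r - m)) = n
      have e : (k : ℝ) + r - m - n * L = ((k - m - n * L : ℤ) : ℝ) + r := by push_cast; ring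
      rw [e]
      have hd0 : k - m - n * L ≠ 0 := fun h => hk ⟨n, by linarith⟩
      have hd1 : k - m - n * L ≠ -1 := fun h => hk1 ⟨n, by linarith⟩
      generalize k - m - n * L = d at *
      rcases lt_trichotomy d 0 with h | h | h
      · have : d ≤ -2 := by omega
        have : (d : ℝ) ≤ -2 := by exact_mod_cast this
        rw [abs_of_nonpos (by linarith)]
        linarith
      · exact absurd h hd0
      · have : (1 : ℝ) ≤ d := by exact_mod_cast h
        rw [abs_of_nonneg (by linarith)]
        linarith

theorem exists_int_add (θ : AddCircle (L : ℝ)) :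
    ∃ (k : ℤ) (r : ℝ), 0 ≤ r ∧ r < 1 ∧ θ = (((k : ℝ) + r : ℝ) : AddCircle (L : ℝ)) := by
  induction θ using QuotientAddGroup.induction_on with
  | H x => exact ⟨⌊x⌋, Int.fract x, Int.fract_nonneg x, Int.fract_lt_one x, by
      rw [Int.floor_add_fract]⟩

theorem tent_injective [NeZero L] (hL : 3 ≤ L) : Function.Injective (tent (L := L)) := by
  classical
  intro θ θ' h
  obtain ⟨k, r, h0, h1, rfl⟩ := exists_int_add θ
  obtain ⟨k', r', h0', h1', rfl⟩ := exists_int_add θ'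
  have H : ∀ p, _ := fun p => (tent_add hL k h0 h1.le p).symm.trans
    ((congrFun h p).trans (tent_add hL k' h0' h1'.le p))
  have : Fact (1 < L) := ⟨by omega⟩
  have hne : ∀ a : ℤ, ((a + 1 : ℤ) : ZMod L) ≠ a := by
    intro a
    simp
  have e1 := H ⟨(k : ZMod L)⟩
  have e2 := H ⟨(k' : ZMod L)⟩
  simp only [GammaVertex.mk.injEq, hne, if_true, if_false, add_zero] at e1 e2
  by_cases hk : (k : ZMod L) = k'
  · have hr : r = r' := by
      rw [if_pos hk.symm, if_neg (by rw [hk]; exact hne k')] at e1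
      linarith
    have := GammaVertex.pos_intCast (L := L) k
    rw [hk, GammaVertex.pos_intCast] at this
    rw [AddCircle.coe_add, AddCircle.coe_add, ← this, hr]
  · exfalso
    rw [if_neg (Ne.symm hk)] at e1
    rw [if_neg hk] at e2
    by_cases h3 : ((k' + 1 : ℤ) : ZMod L) = k
    · have h4 : ((k + 1 : ℤ) : ZMod L) ≠ k' := by
        intro h4
        have h5 : ((2 : ℕ) : ZMod L) = 0 := by
          push_cast at h3 h4 ⊢
          linear_combination h3 + h4
        rw [ZMod.natCast_eq_zero_iff] at h5
        have := Nat.le_of_dvd (by omega) h5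
        omega
      rw [if_neg h4] at e2
      linarith
    · rw [if_neg h3] at e1
      linarith
end

/-- The points of an edge `a ≤ b` in terms of their weights. -/
theorem exists_weights_edge {P : Type} [PartialOrder P] [Fintype P] [DecidableEq P] {a b : P}
    (hab : a ≤ b) {r : ℝ} (h0 : 0 ≤ r) (h1 : r ≤ 1) : ∃ x : SSet.toTop.obj (nerve P),
      ∀ p, weights P x p = (if a = p then 1 - r else 0) + (if b = p then r else 0) := by
  let c : Fin 2 →o P := ⟨![a, b], by
    intro i j hij
    fin_cases i <;> fin_cases j <;> first | (exact le_rfl) | (exact hab) | (simp at hij)⟩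
  refine ⟨cell (n := 1) (chain c) ⟨![1 - r, r], ?_, ?_⟩, fun p => ?_⟩
  · intro i
    fin_cases i
    · simpa using h1
    · exact h0
  · simp [Fin.sum_univ_two]
  · rw [weights_cell, stdSimplex_map_apply, Finset.sum_filter]
    exact Fin.sum_univ_two _

/-- If the poset has no chain of three elements, then every point lies on an edge. -/
theorem exists_edge_of_height {P : Type} [PartialOrder P] [Fintype P] [DecidableEq P]
    (hP : ∀ a b c : P, a < b → ¬ b < c) (x : SSet.toTop.obj (nerve P)) :
    ∃ (a b : P) (r : ℝ), a ≤ b ∧ 0 ≤ r ∧ r ≤ 1 ∧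
      ∀ p, weights P x p = (if a = p then 1 - r else 0) + (if b = p then r else 0) := by
  obtain ⟨n, s, t, rfl⟩ := exists_cell x
  rw [weights_cell]
  set W := stdSimplex.map s.obj t with hW
  obtain ⟨a, b, hab, hs⟩ : ∃ a b, a ≤ b ∧ ∀ i, s.obj i = a ∨ s.obj i = b := by
    by_cases h : ∀ i, s.obj i = s.obj 0
    · exact ⟨_, _, le_rfl, fun i => Or.inl (h i)⟩
    · push Not at h
      obtain ⟨m, hm⟩ := h
      have h0 : ∀ i, s.obj 0 ≤ s.obj i := fun i => nerve_monotone s (Fin.zero_le i)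
      refine ⟨_, _, h0 m, fun i => ?_⟩
      by_contra! hi
      have h1 := lt_of_le_of_ne (h0 m) hm.symm
      have h2 := lt_of_le_of_ne (h0 i) hi.1.symm
      rcases le_total i m with him | him
      · exact hP _ _ _ h2 (lt_of_le_of_ne (nerve_monotone s him) hi.2)
      · exact hP _ _ _ h1 (lt_of_le_of_ne (nerve_monotone s him) hi.2.symm)
  have hsupp : ∀ p, p ≠ a → p ≠ b → W p = 0 := by
    intro p ha hb
    rw [hW, stdSimplex_map_apply]
    refine Finset.sum_eq_zero fun i hi => ?_
    have hi : s.obj i = p := by simpa using hi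
    rcases hs i with h | h
    · exact absurd (hi.symm.trans h) ha
    · exact absurd (hi.symm.trans h) hb
  have hsum : ∑ p, W p = 1 := W.2.2
  have hnn : ∀ p, 0 ≤ W p := W.2.1
  by_cases hne : a = b
  · subst hne
    refine ⟨a, a, 0, le_rfl, le_rfl, zero_le_one, fun p => ?_⟩
    rw [Finset.sum_eq_single a (fun p _ hp => hsupp p hp hp) (by simp)] at hsum
    by_cases hp : a = p
    · subst hp; simp [hsum]
    · simp [hp, hsupp p (Ne.symm hp) (Ne.symm hp)]
  · rw [Finset.sum_eq_add a b hne (fun p _ hp => hsupp p hp.1 hp.2) (by simp) (by simp)] at hsum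
    refine ⟨a, b, W b, hab, hnn b, by linarith [hnn a], fun p => ?_⟩
    by_cases hp : a = p
    · subst hp
      rw [if_pos rfl, if_neg (Ne.symm hne)]
      linarith
    · rw [if_neg hp]
      by_cases hp' : b = p
      · subst hp'; simp
      · rw [if_neg hp', hsupp p (Ne.symm hp) (Ne.symm hp'), add_zero]

/-! ### The realization of `Γ_L` -/

theorem weights_injective (P : Type) [PartialOrder P] [Fintype P] :
    Function.Injective (weights P) := fun x y h =>
  eq_of_weights_eq (J := Unit) (fun _ => 𝟙 (nerve P)) (fun _ _ _ h => h ())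
    fun _ => by rw [realize_id, realize_id, h]

theorem isClosedEmbedding_weights (P : Type) [PartialOrder P] [Fintype P] :
    Topology.IsClosedEmbedding (weights P) :=
  have := compactSpace_realization (nerve P)
  (weights P).continuous.isClosedEmbedding (weights_injective P)

section
variable {L : ℕ}

theorem GammaVertex.le_iff {a b : GammaVertex L} : a ≤ b ↔
    a = b ∨ (Even a.val.val ∧ Odd b.val.val ∧ (a.val - b.val = 1 ∨ a.val - b.val = -1)) := Iff.rfl

theorem even_val_intCast [NeZero L] (hL : 4 ∣ L) (k : ℤ) : Even (k : ZMod L).val ↔ Even k := by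
  have h : (((k : ZMod L).val : ℕ) : ℤ) = k % L := ZMod.val_intCast k
  rw [← Int.even_coe_nat, h, Int.even_iff, Int.even_iff, Int.emod_emod_of_dvd]
  exact_mod_cast (Dvd.dvd.trans (by norm_num) hL : 2 ∣ L)

/-- There are no chains of three elements in the poset underlying `Γ_L`. -/
theorem GammaVertex.height (a b c : GammaVertex L) (h : a < b) : ¬ b < c := by
  intro h'
  rcases GammaVertex.le_iff.1 h.le with e | ⟨-, h2, -⟩
  · exact h.ne e
  · rcases GammaVertex.le_iff.1 h'.le with e | ⟨h3, -⟩
    · exact h'.ne e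
    · exact Nat.not_even_iff_odd.2 h2 h3

open Classical in
theorem exists_weights_eq_tent [NeZero L] (hL : 4 ∣ L) [Fintype (GammaVertex L)]
    (θ : AddCircle (L : ℝ)) : ∃ x : SSet.toTop.obj (nerve (GammaVertex L)),
      ∀ p, weights (GammaVertex L) x p = tent θ p := by
  obtain ⟨k, r, h0, h1, rfl⟩ := exists_int_add θ
  have hL3 : 3 ≤ L := by have := Nat.le_of_dvd (NeZero.pos L) hL; omega
  rcases Int.even_or_odd k with hk | hk
  · obtain ⟨x, hx⟩ := exists_weights_edge (P := GammaVertex L) (a := ⟨(k : ZMod L)⟩)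
      (b := ⟨((k + 1 : ℤ) : ZMod L)⟩)
      (Or.inr ⟨(even_val_intCast hL k).2 hk, Nat.not_even_iff_odd.1 fun h =>
        Int.not_even_iff_odd.2 hk.add_one ((even_val_intCast hL _).1 h), Or.inr (by simp)⟩) h0 h1.le
    exact ⟨x, fun p => (hx p).trans (tent_add hL3 k h0 h1.le p).symm⟩
  -- for odd `k` the edge is oriented from `k + 1` to `k`, so the weights are exchanged
  · obtain ⟨x, hx⟩ := exists_weights_edge (P := GammaVertex L) (a := ⟨((k + 1 : ℤ) : ZMod L)⟩)
      (b := ⟨(k : ZMod L)⟩)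
      (Or.inr ⟨(even_val_intCast hL _).2 hk.add_one, Nat.not_even_iff_odd.1 fun h =>
        Int.not_even_iff_odd.2 hk ((even_val_intCast hL _).1 h), Or.inl (by simp)⟩)
      (sub_nonneg.2 h1.le) (by linarith : 1 - r ≤ 1)
    refine ⟨x, fun p => (hx p).trans ?_⟩
    rw [tent_add hL3 k h0 h1.le p, sub_sub_cancel, add_comm]

open Classical in
theorem exists_tent_eq_weights [NeZero L] (hL : 4 ∣ L) [Fintype (GammaVertex L)]
    (x : SSet.toTop.obj (nerve (GammaVertex L))) :
    ∃ θ : AddCircle (L : ℝ), ∀ p, weights (GammaVertex L) x p = tent θ p := by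
  have hL3 : 3 ≤ L := by have := Nat.le_of_dvd (NeZero.pos L) hL; omega
  obtain ⟨a, b, r, hab, h0, h1, hx⟩ := exists_edge_of_height GammaVertex.height x
  obtain ⟨m, rfl⟩ := a.exists_int
  obtain ⟨m', rfl⟩ := b.exists_int
  rcases GammaVertex.le_iff.1 hab with e | ⟨-, -, e | e⟩
  · refine ⟨((m : ℝ) + (0 : ℝ) : ℝ), fun p => ?_⟩
    rw [tent_add hL3 m le_rfl zero_le_one, hx, ← e]
    split_ifs <;> ring
  · refine ⟨((m' : ℝ) + (1 - r) : ℝ), fun p => ?_⟩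
    have : ((m' + 1 : ℤ) : ZMod L) = m := by
      push_cast
      exact (sub_eq_iff_eq_add'.1 e).symm
    rw [tent_add hL3 m' (sub_nonneg.2 h1) (by linarith), hx, this, sub_sub_cancel, add_comm]
  · refine ⟨((m : ℝ) + r : ℝ), fun p => ?_⟩
    have : ((m + 1 : ℤ) : ZMod L) = m' := by
      push_cast
      linear_combination e
    rw [tent_add hL3 m h0 h1, hx, this]

/-- The realization of `Γ_L` is a circle of circumference `L`. -/
theorem exists_addCircle_homeo [NeZero L] (hL : 4 ∣ L) [Fintype (GammaVertex L)] :
    ∃ f : AddCircle (L : ℝ) ≃ₜ SSet.toTop.obj (nerve (GammaVertex L)),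
      ∀ θ p, weights (GammaVertex L) (f θ) p = tent θ p := by
  choose f hf using exists_weights_eq_tent hL
  have hL3 : 3 ≤ L := by have := Nat.le_of_dvd (NeZero.pos L) hL; omega
  have : Fact (0 < (L : ℝ)) := ⟨by exact_mod_cast NeZero.pos L⟩
  have : T2Space (SSet.toTop.obj (nerve (GammaVertex L))) :=
    t2Space_realization (𝟙 _) fun _ _ _ h => h
  have hcont : Continuous f := by
    rw [(isClosedEmbedding_weights (GammaVertex L)).isInducing.continuous_iff]
    refine Continuous.subtype_mk (continuous_pi fun p => ?_) _
    exact (continuous_tent p).congr fun θ => (hf θ p).symm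
  have hbij : Function.Bijective f := by
    constructor
    · intro θ θ' h
      refine tent_injective hL3 (funext fun p => ?_)
      rw [← hf, ← hf, h]
    · intro x
      obtain ⟨θ, hθ⟩ := exists_tent_eq_weights hL x
      refine ⟨θ, weights_injective _ (stdSimplex.ext (funext fun p => ?_))⟩
      exact (hf θ p).trans (hθ p).symm
  exact ⟨Continuous.homeoOfEquivCompactToT2 (f := Equiv.ofBijective f hbij) hcont, hf⟩

/-- Rotation by half the circumference corresponds to the involution of `Γ_L`. -/
theorem tent_add_half [NeZero L] (hL : 4 ∣ L) (θ : AddCircle (L : ℝ)) (p : GammaVertex L) :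
    tent (θ + ((L / 2 : ℝ) : AddCircle (L : ℝ))) p = tent θ (gammaShift L hL p) := by
  obtain ⟨m, rfl⟩ := p.exists_int
  have e : gammaShift L hL ⟨(m : ZMod L)⟩ = ⟨((m + (L / 2 : ℕ) : ℤ) : ZMod L)⟩ :=
    GammaVertex.ext' (by
      change (m : ZMod L) + ((L / 2 : ℕ) : ZMod L) = _
      rw [Int.cast_add, Int.cast_natCast])
  have h2 : ((L / 2 : ℕ) : ℝ) = (L : ℝ) / 2 :=
    Nat.cast_div (Dvd.dvd.trans (by norm_num) hL) (by norm_num)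
  have h3 : ((L / 2 : ℝ) : AddCircle (L : ℝ)) + ((L / 2 : ℝ) : AddCircle (L : ℝ)) = 0 := by
    rw [← AddCircle.coe_add, add_halves]
    exact AddCircle.coe_period _
  rw [tent, tent, e, GammaVertex.pos_intCast, GammaVertex.pos_intCast]
  rw [Int.cast_add, Int.cast_natCast, h2, AddCircle.coe_add, ← sub_sub,
    sub_eq_add_neg _ ((L / 2 : ℝ) : AddCircle (L : ℝ)),
    ← eq_neg_of_add_eq_zero_left h3]
  congr 3
  abel

theorem addCircle_homeo_add_half [NeZero L] (hL : 4 ∣ L) [Fintype (GammaVertex L)]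
    {f : AddCircle (L : ℝ) ≃ₜ SSet.toTop.obj (nerve (GammaVertex L))}
    (hf : ∀ θ p, weights (GammaVertex L) (f θ) p = tent θ p) (θ : AddCircle (L : ℝ)) :
    f (θ + ((L / 2 : ℝ) : AddCircle (L : ℝ))) = realize (gamma L hL).inv (f θ) := by
  classical
  have hinv : ∀ p, gammaShift L hL (gammaShift L hL p) = p := by
    intro p
    refine GammaVertex.ext' ?_
    have h : L / 2 + L / 2 = L := by omega
    change p.val + ((L / 2 : ℕ) : ZMod L) + ((L / 2 : ℕ) : ZMod L) = p.val
    rw [add_assoc, ← Nat.cast_add, h, ZMod.natCast_self, add_zero]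
  refine weights_injective _ (stdSimplex.ext (funext fun p => ?_))
  refine (hf _ p).trans ((tent_add_half hL θ p).trans ((hf θ _).symm.trans ?_))
  have h := weights_realize (F := (gamma L hL).inv) (f := gammaShift L hL) (fun _ _ _ => rfl) (f θ)
  refine Eq.trans ?_ (congrArg (fun W : stdSimplex ℝ (GammaVertex L) => W p) h).symm
  rw [stdSimplex_map_apply]
  symm
  refine Finset.sum_eq_single_of_mem _ (by simp [hinv]) fun q hq hne => ?_
  refine absurd ?_ hne
  rw [← hinv q, (Finset.mem_filter.1 hq).2]

/-- The circle is equivariantly homeomorphic to the realization of `Γ_L`. -/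
theorem exists_circle_homeo [NeZero L] (hL : 4 ∣ L) :
    ∃ h : circle ≃ₜ (gamma L hL).realization,
      ∀ z, h (circle.inv z) = (gamma L hL).realization.inv (h z) := by
  have := Fintype.ofFinite (GammaVertex L)
  obtain ⟨f, hf⟩ := exists_addCircle_homeo hL
  have hL0 : (L : ℝ) ≠ 0 := by exact_mod_cast NeZero.ne L
  let c : AddCircle (L : ℝ) ≃ₜ Circle := AddCircle.homeomorphCircle hL0
  have hc : ∀ θ, c (θ + ((L / 2 : ℝ) : AddCircle (L : ℝ))) = - c θ := by
    intro θ
    have e : AddCircle.toCircle ((L / 2 : ℝ) : AddCircle (L : ℝ)) = -1 := by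
      rw [AddCircle.toCircle_apply_mk, show 2 * Real.pi / L * (L / 2) = Real.pi by field_simp]
      exact Circle.ext (by simp)
    rw [AddCircle.homeomorphCircle_apply, AddCircle.homeomorphCircle_apply,
      AddCircle.toCircle_add, e, mul_neg, mul_one]
  refine ⟨c.symm.trans f, fun z => ?_⟩
  obtain ⟨θ, rfl⟩ := c.surjective z
  have h1 : c.symm (circle.inv (c θ)) = θ + ((L / 2 : ℝ) : AddCircle (L : ℝ)) :=
    c.symm_apply_eq.2 (hc θ).symm
  change f (c.symm (circle.inv (c θ))) = realize (gamma L hL).inv (f (c.symm (c θ)))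
  rw [h1, Homeomorph.symm_apply_apply]
  exact addCircle_homeo_add_half hL hf θ
end

/-! ### The homomorphism complex of an odd cycle -/

/-- The integer `c` represents the vertex `(u, v)` of the bipartite double cover of `C_ℓ`. -/
def Represents (ℓ : ℕ) (c : ℤ) (u : Fin 2) (v : Fin ℓ) : Prop :=
  (2 : ℤ) ∣ c - (u : ℕ) ∧ (ℓ : ℤ) ∣ c - (v : ℕ)

section
variable {ℓ : ℕ}

theorem cycle_adj_iff (hℓ : 3 ≤ ℓ) (a b : Fin ℓ) :
    (cycle ℓ).Adj a b ↔ (ℓ : ℤ) ∣ (a : ℕ) - (b : ℕ) - 1 ∨ (ℓ : ℤ) ∣ (a : ℕ) - (b : ℕ) + 1 := by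
  have key : ∀ a b : Fin ℓ, (a - b).val = 1 ↔ (ℓ : ℤ) ∣ (a : ℕ) - (b : ℕ) - 1 := by
    intro a b
    rw [Fin.sub_def]
    have ha := a.2
    have hb := b.2
    simp only
    constructor
    · intro h
      have h2 := Nat.div_add_mod (ℓ - b + a) ℓ
      rw [h] at h2
      refine ⟨(((ℓ - b + a) / ℓ : ℕ) : ℤ) - 1, ?_⟩
      have h3 : (ℓ : ℤ) * (((ℓ - b + a) / ℓ : ℕ) : ℤ) + 1 = ℓ - b + a := by
        rw [← Nat.cast_sub hb.le]
        exact_mod_cast h2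
      linarith
    · rintro ⟨c, hc⟩
      have h3 : ((ℓ - b + a : ℕ) : ℤ) = 1 + ℓ * (c + 1) := by
        rw [Nat.cast_add, Nat.cast_sub hb.le]
        linarith
      have h4 : (((ℓ - b + a) % ℓ : ℕ) : ℤ) = 1 := by
        rw [Int.natCast_mod, h3, Int.add_mul_emod_self_left]
        exact Int.emod_eq_of_lt (by norm_num) (by omega)
      exact_mod_cast h4
  rw [SimpleGraph.cycleGraph_adj', key, key]
  refine or_congr_right ?_
  rw [← dvd_neg]
  ring_nf

theorem exists_represents (hodd : Odd ℓ) (u : Fin 2) (v : Fin ℓ) : ∃ c, Represents ℓ c u v := by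
  obtain ⟨k, hk⟩ := hodd
  rcases Int.even_or_odd' ((v : ℕ) - (u : ℕ) : ℤ) with ⟨d, hd | hd⟩
  · exact ⟨(v : ℕ), ⟨d, by linarith⟩, ⟨0, by ring⟩⟩
  · exact ⟨(v : ℕ) + ℓ, ⟨d + k + 1, by push_cast [hk]; linarith⟩, ⟨1, by ring⟩⟩

theorem exists_represented (hℓ : 0 < ℓ) (c : ℤ) : ∃ u v, Represents ℓ c u v := by
  have h2 := Int.emod_nonneg c (by norm_num : (2 : ℤ) ≠ 0)
  have h2' := Int.emod_lt_of_pos c (by norm_num : (0 : ℤ) < 2)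
  have hl := Int.emod_nonneg c (by omega : (ℓ : ℤ) ≠ 0)
  have hl' := Int.emod_lt_of_pos c (by omega : (0 : ℤ) < ℓ)
  refine ⟨⟨(c % 2).toNat, by omega⟩, ⟨(c % ℓ).toNat, by omega⟩, ?_, ?_⟩
  · simp only [Int.toNat_of_nonneg h2]
    exact Int.dvd_self_sub_emod
  · simp only [Int.toNat_of_nonneg hl]
    exact Int.dvd_self_sub_emod

theorem Represents.eq {c : ℤ} {u u' : Fin 2} {v v' : Fin ℓ} (h : Represents ℓ c u v)
    (h' : Represents ℓ c u' v') : u = u' ∧ v = v' := by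
  have key : ∀ (N a b : ℕ), a < N → b < N → (N : ℤ) ∣ c - a → (N : ℤ) ∣ c - b → a = b := by
    intro N a b ha hb h1 h2
    have h3 : (N : ℤ) ∣ (b : ℤ) - a := by
      have := dvd_sub h1 h2
      rwa [sub_sub_sub_cancel_left] at this
    exact Nat.ModEq.eq_of_lt_of_lt ((Nat.modEq_iff_dvd).2 h3) ha hb
  exact ⟨Fin.ext (key 2 _ _ u.2 u'.2 h.1 h'.1), Fin.ext (key ℓ _ _ v.2 v'.2 h.2 h'.2)⟩

theorem dvd_of_odd (hodd : Odd ℓ) {d : ℤ} (h2 : 2 ∣ d) (hl : (ℓ : ℤ) ∣ d) :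
    ∃ n, d = 2 * ℓ * n := by
  have h : IsCoprime (2 : ℤ) ℓ := by
    rw [Int.isCoprime_iff_gcd_eq_one, Int.gcd_comm]
    exact Nat.Coprime.symm (Nat.coprime_two_left.2 hodd)
  exact h.mul_dvd h2 hl

theorem Represents.exists_eq_add (hodd : Odd ℓ) {c c' : ℤ} {u : Fin 2} {v : Fin ℓ}
    (h : Represents ℓ c u v) (h' : Represents ℓ c' u v) : ∃ n, c' = c + 2 * ℓ * n := by
  obtain ⟨n, hn⟩ := dvd_of_odd hodd (d := c' - c) (by
      have := dvd_sub h'.1 h.1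
      rwa [sub_sub_sub_cancel_right] at this) (by
      have := dvd_sub h'.2 h.2
      rwa [sub_sub_sub_cancel_right] at this)
  exact ⟨n, by linarith⟩

theorem Represents.add {c : ℤ} {u : Fin 2} {v : Fin ℓ} (h : Represents ℓ c u v) (n : ℤ) :
    Represents ℓ (c + 2 * ℓ * n) u v := by
  constructor
  · rw [show c + 2 * ℓ * n - (u : ℕ) = (c - (u : ℕ)) + 2 * (ℓ * n) by ring]
    exact dvd_add h.1 (dvd_mul_right _ _)
  · rw [show c + 2 * ℓ * n - (v : ℕ) = (c - (v : ℕ)) + ℓ * (2 * n) by ring]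
    exact dvd_add h.2 (dvd_mul_right _ _)

/-- The multihomomorphism `K₂ → C_ℓ` with index `j`: an edge of the bipartite double cover for even
`j`, the star of a vertex for odd `j`. In the double cover, a cycle of length `2ℓ`, it
consists of the vertices at distance at most `1` from the point `(j + 1) / 2`. -/
def starMultiHom (hℓ : 3 ≤ ℓ) (j : ℤ) : MultiHom K2 (cycle ℓ) :=
  ⟨fun u => {v | ∃ c, Represents ℓ c u v ∧ j - 1 ≤ 2 * c ∧ 2 * c ≤ j + 3}, by
    intro u
    obtain ⟨c, hc, h1, h2⟩ : ∃ c : ℤ, 2 ∣ c - (u : ℕ) ∧ j - 1 ≤ 2 * c ∧ 2 * c ≤ j + 3 := by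
      by_cases h : (2 : ℤ) ∣ j / 2 - (u : ℕ)
      · exact ⟨j / 2, h, by omega, by omega⟩
      · exact ⟨j / 2 + 1, by omega, by omega, by omega⟩
    obtain ⟨u', v, h⟩ := exists_represented (by omega : 0 < ℓ) c
    have : (u' : ℕ) = u := by
      have := h.1
      omega
    exact ⟨v, c, ⟨hc, h.2⟩, h1, h2⟩, by
    rintro u u' huu' v ⟨c, hc, h1, h2⟩ v' ⟨c', hc', h1', h2'⟩
    have hne : (u : ℕ) ≠ u' := fun h => (SimpleGraph.top_adj _ _).1 huu' (Fin.ext h)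
    rw [cycle_adj_iff hℓ]
    have e1 := hc.1
    have e2 := hc'.1
    have h : c - c' = 1 ∨ c - c' = -1 := by omega
    have hd := dvd_sub hc'.2 hc.2
    refine h.imp (fun h => ?_) fun h => ?_
    · rwa [show ((v : ℕ) : ℤ) - (v' : ℕ) - 1 = c' - (v' : ℕ) - (c - (v : ℕ)) by linarith]
    · rwa [show ((v : ℕ) : ℤ) - (v' : ℕ) + 1 = c' - (v' : ℕ) - (c - (v : ℕ)) by linarith]⟩

theorem mem_starMultiHom {hℓ : 3 ≤ ℓ} {j : ℤ} {u : Fin 2} {v : Fin ℓ} :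
    v ∈ (starMultiHom hℓ j).1 u ↔ ∃ c, Represents ℓ c u v ∧ j - 1 ≤ 2 * c ∧ 2 * c ≤ j + 3 :=
  Iff.rfl

theorem Represents.mem_starMultiHom_iff (hodd : Odd ℓ) {hℓ : 3 ≤ ℓ} {j c : ℤ} {u : Fin 2}
    {v : Fin ℓ} (h : Represents ℓ c u v) : v ∈ (starMultiHom hℓ j).1 u ↔
      ∃ n : ℤ, j - 1 ≤ 2 * (c + 2 * ℓ * n) ∧ 2 * (c + 2 * ℓ * n) ≤ j + 3 := by
  rw [mem_starMultiHom]
  constructor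
  · rintro ⟨c', h', h1, h2⟩
    obtain ⟨n, rfl⟩ := h.exists_eq_add hodd h'
    exact ⟨n, h1, h2⟩
  · rintro ⟨n, h1, h2⟩
    exact ⟨_, h.add n, h1, h2⟩

theorem multiHom_le_iff {V W : Type} {F : SimpleGraph V} {G : SimpleGraph W} {m m' : MultiHom F G} :
    m ≤ m' ↔ ∀ u, m.1 u ⊆ m'.1 u := Iff.rfl

theorem starMultiHom_le_iff (hodd : Odd ℓ) (hℓ : 3 ≤ ℓ) (i j : ℤ) :
    starMultiHom hℓ i ≤ starMultiHom hℓ j ↔ (∃ n, i = j + 4 * ℓ * n) ∨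
      (Even i ∧ Odd j ∧ ((∃ n, i - j = 1 + 4 * ℓ * n) ∨ ∃ n, i - j = -1 + 4 * ℓ * n)) := by
  constructor
  · intro H
    have H' : ∀ c, i - 1 ≤ 2 * c → 2 * c ≤ i + 3 →
        ∃ n : ℤ, j - 1 ≤ 2 * (c + 2 * ℓ * n) ∧ 2 * (c + 2 * ℓ * n) ≤ j + 3 := by
      intro c h1 h2
      obtain ⟨u, v, h⟩ := exists_represented (by omega : 0 < ℓ) c
      exact (h.mem_starMultiHom_iff hodd).1 (multiHom_le_iff.1 H u ⟨c, h, h1, h2⟩)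
    -- consecutive integers are matched by the same shift, as the period is at least `6`
    have hshift : ∀ c n n' : ℤ, j - 1 ≤ 2 * (c + 2 * ℓ * n) ∧ 2 * (c + 2 * ℓ * n) ≤ j + 3 →
        j - 1 ≤ 2 * (c + 1 + 2 * ℓ * n') ∧ 2 * (c + 1 + 2 * ℓ * n') ≤ j + 3 → n' = n := by
      intro c n n' h h'
      by_contra hne
      have hℓ' : (3 : ℤ) ≤ ℓ := by exact_mod_cast hℓ
      rcases lt_or_gt_of_ne hne with hlt | hlt
      · have : (3 : ℤ) * 1 ≤ ℓ * (n - n') :=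
          mul_le_mul hℓ' (by omega) (by norm_num) (by omega)
        nlinarith
      · have : (3 : ℤ) * 1 ≤ ℓ * (n' - n) :=
          mul_le_mul hℓ' (by omega) (by norm_num) (by omega)
        nlinarith
    obtain ⟨n, hn⟩ := H' (i / 2) (by omega) (by omega)
    obtain ⟨n1, hn1⟩ := H' (i / 2 + 1) (by omega) (by omega)
    obtain rfl := hshift _ _ _ hn hn1
    rcases Int.even_or_odd i with hi | hi
    · have hi' := hi
      obtain ⟨a, rfl⟩ := hi
      rw [show (a + a) / 2 = a by omega] at hn hn1
      obtain ⟨N, hN⟩ : ∃ N, N = 2 * (ℓ : ℤ) * n1 := ⟨_, rfl⟩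
      rw [← hN] at hn hn1
      have : j = 2 * N + 2 * a ∨ j = 2 * N + 2 * a + 1 ∨ j = 2 * N + 2 * a - 1 := by omega
      rcases this with h | h | h
      · exact Or.inl ⟨-n1, by linarith⟩
      · exact Or.inr ⟨hi', ⟨N + a, by linarith⟩, Or.inr ⟨-n1, by linarith⟩⟩
      · exact Or.inr ⟨hi', ⟨N + a - 1, by linarith⟩, Or.inl ⟨-n1, by linarith⟩⟩
    · obtain ⟨a, rfl⟩ := hi
      obtain ⟨n2, hn2⟩ := H' ((2 * a + 1) / 2 + 1 + 1) (by omega) (by omega)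
      obtain rfl := hshift _ _ _ hn1 hn2
      rw [show (2 * a + 1) / 2 = a by omega] at hn hn2
      exact Or.inl ⟨-n2, by linarith⟩
  · have key : ∀ d n : ℤ, i - j = d + 4 * ℓ * n → (∀ c, i - 1 ≤ 2 * c → 2 * c ≤ i + 3 →
        i - d - 1 ≤ 2 * c ∧ 2 * c ≤ i - d + 3) → starMultiHom hℓ i ≤ starMultiHom hℓ j := by
      intro d n hd H
      refine multiHom_le_iff.2 fun u v hv => ?_
      obtain ⟨c, hc, h1, h2⟩ := hv
      refine (hc.mem_starMultiHom_iff hodd).2 ⟨-n, ?_⟩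
      have h3 := H c h1 h2
      constructor <;> linarith [h3.1, h3.2]
    rintro (⟨n, hn⟩ | ⟨⟨a, ha⟩, -, ⟨n, hn⟩ | ⟨n, hn⟩⟩)
    · exact key 0 n (by linarith) fun c h1 h2 => ⟨by linarith, by linarith⟩
    · exact key 1 n hn fun c h1 h2 => ⟨by omega, by omega⟩
    · exact key (-1) n hn fun c h1 h2 => ⟨by omega, by omega⟩

/-- Lifted to the double cover, a multihomomorphism contains two consecutive vertices `k`, `k + 1`,
and all its other vertices are adjacent to one of them; it cannot contain both `k - 1` and `k + 2`,
which are not adjacent as the cycle has length at least `6`. -/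
theorem exists_starMultiHom_eq (hodd : Odd ℓ) (hℓ : 3 ≤ ℓ) (m : MultiHom K2 (cycle ℓ)) :
    ∃ j, starMultiHom hℓ j = m := by
  -- the lift of `m` to the universal cover of the double cover
  let S : ℤ → Prop := fun c => ∃ u v, Represents ℓ c u v ∧ v ∈ m.1 u
  have hS : ∀ {c u v}, Represents ℓ c u v → (S c ↔ v ∈ m.1 u) := by
    intro c u v h
    refine ⟨?_, fun hv => ⟨u, v, h, hv⟩⟩
    rintro ⟨u', v', h', hv⟩
    obtain ⟨rfl, rfl⟩ := h.eq h'
    exact hv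
  have hSadd : ∀ c n, S c → S (c + 2 * ℓ * n) := fun c n ⟨u, v, h, hv⟩ => ⟨u, v, h.add n, hv⟩
  have hadj : ∀ c c', S c → S c' → ¬ (2 : ℤ) ∣ c - c' →
      ∃ n : ℤ, c' = c + 1 + 2 * ℓ * n ∨ c' = c - 1 + 2 * ℓ * n := by
    rintro c c' ⟨u, v, h, hv⟩ ⟨u', v', h', hv'⟩ hne
    have h2 := h.1
    have h2' := h'.1
    have huu' : u ≠ u' := by
      rintro rfl
      omega
    have hd := dvd_sub h'.2 h.2
    rcases (cycle_adj_iff hℓ v v').1 (m.2.2 u u' ((SimpleGraph.top_adj _ _).2 huu') v hv v' hv')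
      with ha | ha
    · obtain ⟨n, hn⟩ := dvd_of_odd hodd (d := c' - (c - 1)) (by omega) (by
        have := dvd_sub hd ha
        rwa [show c' - (v' : ℕ) - (c - (v : ℕ)) - ((v : ℕ) - (v' : ℕ) - 1) = c' - (c - 1) by ring]
          at this)
      exact ⟨n, Or.inr (by linarith)⟩
    · obtain ⟨n, hn⟩ := dvd_of_odd hodd (d := c' - (c + 1)) (by omega) (by
        have := dvd_sub hd ha
        rwa [show c' - (v' : ℕ) - (c - (v : ℕ)) - ((v : ℕ) - (v' : ℕ) + 1) = c' - (c + 1) by ring]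
          at this)
      exact ⟨n, Or.inl (by linarith)⟩
  have finish : ∀ j, (∀ c, S c ↔
      ∃ n : ℤ, j - 1 ≤ 2 * (c + 2 * ℓ * n) ∧ 2 * (c + 2 * ℓ * n) ≤ j + 3) →
      starMultiHom hℓ j = m := by
    intro j hj
    refine Subtype.ext (funext fun u => Set.ext fun v => ?_)
    obtain ⟨c, hc⟩ := exists_represents hodd u v
    rw [hc.mem_starMultiHom_iff hodd, ← hj, hS hc]
  obtain ⟨k, hk, hk1⟩ : ∃ k, S k ∧ S (k + 1) := by
    obtain ⟨a, ha⟩ := m.2.1 0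
    obtain ⟨b, hb⟩ := m.2.1 1
    obtain ⟨c, hc⟩ := exists_represents hodd 0 a
    obtain ⟨c', hc'⟩ := exists_represents hodd 1 b
    have h1 := (hS hc).2 ha
    have h2 := (hS hc').2 hb
    obtain ⟨n, hn | hn⟩ := hadj c c' h1 h2 (by
      have h3 := hc.1
      have h4 := hc'.1
      simp only [Fin.val_zero, Fin.val_one] at h3 h4
      omega)
    · refine ⟨c, h1, ?_⟩
      have := hSadd c' (-n) h2
      rwa [hn, show c + 1 + 2 * (ℓ : ℤ) * n + 2 * ℓ * -n = c + 1 by ring] at this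
    · refine ⟨c - 1, ?_, by rwa [sub_add_cancel]⟩
      have := hSadd c' (-n) h2
      rwa [hn, show c - 1 + 2 * (ℓ : ℤ) * n + 2 * ℓ * -n = c - 1 by ring] at this
  have hcases : ∀ c, S c → ∃ n : ℤ, c = k - 1 + 2 * ℓ * n ∨ c = k + 2 * ℓ * n ∨
      c = k + 1 + 2 * ℓ * n ∨ c = k + 2 + 2 * ℓ * n := by
    intro c hc
    by_cases h : (2 : ℤ) ∣ k - c
    · obtain ⟨n, hn | hn⟩ := hadj (k + 1) c hk1 hc (by omega)
      · exact ⟨n, Or.inr (Or.inr (Or.inr (by linarith)))⟩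
      · exact ⟨n, Or.inr (Or.inl (by linarith))⟩
    · obtain ⟨n, hn | hn⟩ := hadj k c hk hc h
      · exact ⟨n, Or.inr (Or.inr (Or.inl (by linarith)))⟩
      · exact ⟨n, Or.inl (by linarith)⟩
  have hback : ∀ a n c : ℤ, c + 2 * ℓ * n = a → S a → S c := by
    intro a n c h ha
    have := hSadd a (-n) ha
    rwa [← h, show c + 2 * (ℓ : ℤ) * n + 2 * ℓ * -n = c by ring] at this
  by_cases h2 : S (k + 2)
  · have hm1 : ¬ S (k - 1) := by
      intro h
      have hℓ' : (3 : ℤ) ≤ ℓ := by exact_mod_cast hℓ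
      obtain ⟨n, hn⟩ : ∃ n : ℤ, (ℓ : ℤ) * n = -1 ∨ (ℓ : ℤ) * n = -2 := by
        obtain ⟨n, hn | hn⟩ := hadj (k + 2) (k - 1) h2 h (by omega)
        · exact ⟨n, Or.inr (by linarith)⟩
        · exact ⟨n, Or.inl (by linarith)⟩
      have hd : (ℓ : ℤ) ∣ 1 ∨ (ℓ : ℤ) ∣ 2 :=
        hn.imp (fun h => ⟨-n, by linarith⟩) fun h => ⟨-n, by linarith⟩
      rcases hd with hd | hd
      · have := Int.le_of_dvd (by norm_num) hd
        omega
      · have := Int.le_of_dvd (by norm_num) hd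
        omega
    refine ⟨2 * k + 1, finish _ fun c => ⟨fun hc => ?_, ?_⟩⟩
    · obtain ⟨n, hn | hn | hn | hn⟩ := hcases c hc
      · exact absurd (hback c n (k - 1) hn.symm hc) hm1
      all_goals exact ⟨-n, by linarith, by linarith⟩
    · rintro ⟨n, h3, h4⟩
      obtain ⟨a, ha⟩ : ∃ a, c + 2 * ℓ * n = a := ⟨_, rfl⟩
      rw [ha] at h3 h4
      refine hback a n c ha ?_
      obtain rfl | rfl | rfl : a = k ∨ a = k + 1 ∨ a = k + 2 := by omega
      exacts [hk, hk1, h2]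
  · by_cases hm1 : S (k - 1)
    · refine ⟨2 * k - 1, finish _ fun c => ⟨fun hc => ?_, ?_⟩⟩
      · obtain ⟨n, hn | hn | hn | hn⟩ := hcases c hc
        on_goal 4 => exact absurd (hback c n (k + 2) hn.symm hc) h2
        all_goals exact ⟨-n, by linarith, by linarith⟩
      · rintro ⟨n, h3, h4⟩
        obtain ⟨a, ha⟩ : ∃ a, c + 2 * ℓ * n = a := ⟨_, rfl⟩
        rw [ha] at h3 h4
        refine hback a n c ha ?_
        obtain rfl | rfl | rfl : a = k - 1 ∨ a = k ∨ a = k + 1 := by omega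
        exacts [hm1, hk, hk1]
    · refine ⟨2 * k, finish _ fun c => ⟨fun hc => ?_, ?_⟩⟩
      · obtain ⟨n, hn | hn | hn | hn⟩ := hcases c hc
        · exact absurd (hback c n (k - 1) hn.symm hc) hm1
        on_goal 3 => exact absurd (hback c n (k + 2) hn.symm hc) h2
        all_goals exact ⟨-n, by linarith, by linarith⟩
      · rintro ⟨n, h3, h4⟩
        obtain ⟨a, ha⟩ : ∃ a, c + 2 * ℓ * n = a := ⟨_, rfl⟩
        rw [ha] at h3 h4
        refine hback a n c ha ?_
        obtain rfl | rfl : a = k ∨ a = k + 1 := by omega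
        exacts [hk, hk1]

/-- Going half-way around the double cover exchanges its two sheets. -/
theorem starMultiHom_add_half (hℓ : 3 ≤ ℓ) (hodd : Odd ℓ) (j : ℤ) :
    starMultiHom hℓ (j + 2 * ℓ) = multiHomSwap (cycle ℓ) (starMultiHom hℓ j) := by
  refine Subtype.ext (funext fun u => Set.ext fun v => ?_)
  change _ ↔ v ∈ (starMultiHom hℓ j).1 (Equiv.swap (0 : Fin 2) 1 u)
  have hsw : ((Equiv.swap (0 : Fin 2) 1 u : ℕ) : ℤ) = 1 - (u : ℕ) := by
    fin_cases u <;> simp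
  obtain ⟨q, hq⟩ := hodd
  have hrep : ∀ c, Represents ℓ (c + ℓ) u v ↔ Represents ℓ c (Equiv.swap (0 : Fin 2) 1 u) v := by
    intro c
    refine and_congr ?_ ?_
    · rw [hsw]
      have : (ℓ : ℤ) = 2 * q + 1 := by exact_mod_cast hq
      omega
    · rw [show c + ℓ - ((v : ℕ) : ℤ) = c - (v : ℕ) + ℓ by ring, dvd_add_self_right]
  rw [mem_starMultiHom, mem_starMultiHom]
  constructor
  · rintro ⟨c, hc, h1, h2⟩
    refine ⟨c - ℓ, (hrep _).1 (by rwa [sub_add_cancel]), by linarith, by linarith⟩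
  · rintro ⟨c, hc, h1, h2⟩
    exact ⟨c + ℓ, (hrep c).2 hc, by linarith, by linarith⟩

theorem intCast_zmod_eq_iff {L : ℕ} (a b : ℤ) :
    (a : ZMod L) = b ↔ ∃ n : ℤ, a = b + L * n := by
  rw [ZMod.intCast_eq_intCast_iff_dvd_sub]
  exact ⟨fun ⟨c, hc⟩ => ⟨-c, by linarith⟩, fun ⟨c, hc⟩ => ⟨-c, by linarith⟩⟩

theorem starMultiHom_val_le_iff (hodd : Odd ℓ) (hℓ : 3 ≤ ℓ) (a b : GammaVertex (4 * ℓ)) :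
    starMultiHom hℓ a.val.val ≤ starMultiHom hℓ b.val.val ↔ a ≤ b := by
  have : NeZero (4 * ℓ) := ⟨by omega⟩
  have hv : ∀ a : GammaVertex (4 * ℓ), (((a.val.val : ℕ) : ℤ) : ZMod (4 * ℓ)) = a.val := by simp
  rw [starMultiHom_le_iff hodd, GammaVertex.le_iff, Int.even_coe_nat, Int.odd_coe_nat]
  have e0 : a = b ↔ ∃ n, ((a.val.val : ℕ) : ℤ) = (b.val.val : ℕ) + 4 * ℓ * n := by
    have := intCast_zmod_eq_iff (L := 4 * ℓ) (a.val.val : ℕ) (b.val.val : ℕ)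
    rw [hv, hv] at this
    push_cast at this
    rw [← this]
    exact ⟨fun h => by rw [h], GammaVertex.ext'⟩
  have e1 : ∀ d : ℤ, a.val - b.val = d ↔
      ∃ n, ((a.val.val : ℕ) : ℤ) - (b.val.val : ℕ) = d + 4 * ℓ * n := by
    intro d
    have := intCast_zmod_eq_iff (L := 4 * ℓ) ((a.val.val : ℕ) - (b.val.val : ℕ)) d
    rw [Int.cast_sub, hv, hv] at this
    push_cast at this
    exact this
  have e2 := e1 1
  have e3 := e1 (-1)
  rw [Int.cast_neg, Int.cast_one] at e3
  rw [Int.cast_one] at e2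
  rw [e0, e2, e3]

/-- The poset of multihomomorphisms `K₂ → C_ℓ` is the poset underlying `Γ_{4ℓ}`. -/
noncomputable def gammaIso (hodd : Odd ℓ) (hℓ : 3 ≤ ℓ) :
    GammaVertex (4 * ℓ) ≃o MultiHom K2 (cycle ℓ) :=
  RelIso.ofSurjective (OrderEmbedding.ofMapLEIff (fun a => starMultiHom hℓ a.val.val)
    (starMultiHom_val_le_iff hodd hℓ)) (by
    intro m
    have : NeZero (4 * ℓ) := ⟨by omega⟩
    obtain ⟨j, rfl⟩ := exists_starMultiHom_eq hodd hℓ m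
    refine ⟨⟨(j : ZMod (4 * ℓ))⟩, ?_⟩
    have h : (((j : ZMod (4 * ℓ)).val : ℕ) : ℤ) = j + 4 * ℓ * -(j / (4 * ℓ)) := by
      rw [ZMod.val_intCast, Int.emod_def]
      push_cast
      ring
    refine le_antisymm ((starMultiHom_le_iff hodd hℓ _ _).2 (Or.inl ⟨_, h⟩))
      ((starMultiHom_le_iff hodd hℓ _ _).2 (Or.inl ⟨j / (4 * ℓ), ?_⟩))
    rw [h]
    ring)

theorem gammaIso_apply (hodd : Odd ℓ) (hℓ : 3 ≤ ℓ) (a : GammaVertex (4 * ℓ)) :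
    gammaIso hodd hℓ a = starMultiHom hℓ a.val.val := rfl

theorem gammaIso_shift (hodd : Odd ℓ) (hℓ : 3 ≤ ℓ) (a : GammaVertex (4 * ℓ)) :
    gammaIso hodd hℓ (gammaShift (4 * ℓ) (Dvd.intro ℓ rfl) a) =
      multiHomSwap (cycle ℓ) (gammaIso hodd hℓ a) := by
  have : NeZero (4 * ℓ) := ⟨by omega⟩
  rw [gammaIso_apply, gammaIso_apply, ← starMultiHom_add_half hℓ hodd]
  have h := (intCast_zmod_eq_iff (L := 4 * ℓ)
    ((gammaShift (4 * ℓ) (Dvd.intro ℓ rfl) a).val.val : ℕ) ((a.val.val : ℕ) + 2 * ℓ)).1 (by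
      have e : 4 * ℓ / 2 = 2 * ℓ := by omega
      change ((((a.val + ((4 * ℓ / 2 : ℕ) : ZMod (4 * ℓ))).val : ℕ) : ℤ) : ZMod (4 * ℓ)) = _
      rw [e]
      simp)
  obtain ⟨n, hn⟩ := h
  push_cast at hn
  refine le_antisymm ((starMultiHom_le_iff hodd hℓ _ _).2 (Or.inl ⟨n, hn⟩))
    ((starMultiHom_le_iff hodd hℓ _ _).2 (Or.inl ⟨-n, ?_⟩))
  rw [hn]
  ring
end

/-! ### Colouring the homomorphism complex of `K₄` -/

theorem K4_adj_iff (a b : Fin 4) : K4.Adj a b ↔ a ≠ b := SimpleGraph.top_adj a b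

/-- The total number of vertices used by a multihomomorphism `K₂ → K₄`. -/
noncomputable def multiHomRank (m : MultiHom K2 K4) : ℕ := (m.1 0).ncard + (m.1 1).ncard

theorem multiHomRank_strictMono : StrictMono multiHomRank := by
  intro m m' h
  have hle : ∀ u, m.1 u ⊆ m'.1 u := h.le
  have h0 := Set.ncard_le_ncard (hle 0)
  have h1 := Set.ncard_le_ncard (hle 1)
  by_contra hlt
  have hlt' : multiHomRank m' ≤ multiHomRank m := not_lt.1 hlt
  unfold multiHomRank at hlt'
  have e0 := Set.eq_of_subset_of_ncard_le (hle 0) (by omega)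
  have e1 := Set.eq_of_subset_of_ncard_le (hle 1) (by omega)
  refine h.ne (Subtype.ext (funext fun u => ?_))
  fin_cases u
  · exact e0
  · exact e1

theorem two_le_multiHomRank (m : MultiHom K2 K4) : 2 ≤ multiHomRank m := by
  have h0 := (Set.ncard_pos).2 (m.2.1 0)
  have h1 := (Set.ncard_pos).2 (m.2.1 1)
  unfold multiHomRank
  omega

theorem multiHom_disjoint (m : MultiHom K2 K4) : Disjoint (m.1 0) (m.1 1) :=
  Set.disjoint_left.2 fun a h0 h1 =>
    (K4_adj_iff a a).1 (m.2.2 0 1 ((SimpleGraph.top_adj _ _).2 (by decide)) a h0 a h1) rfl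

theorem multiHomRank_le_four (m : MultiHom K2 K4) : multiHomRank m ≤ 4 := by
  rw [multiHomRank, ← Set.ncard_union_eq (multiHom_disjoint m)]
  simpa using Set.ncard_le_card (m.1 0 ∪ m.1 1)

/-- A sequence of colours that changes only when a monotone rank with values in `{2, 3, 4}`
increases has at most two alternations. -/
theorem alternations_le_two {k : ℕ} {u : Fin (k + 1) → Bool} {r : Fin (k + 1) → ℕ}
    (hr : Monotone r) (h2 : ∀ i, 2 ≤ r i) (h4 : ∀ i, r i ≤ 4)
    (hu : ∀ i : Fin k, u i.castSucc ≠ u i.succ → r i.castSucc < r i.succ) :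
    alternations u ≤ 2 := by
  refine (Finset.card_le_card_of_injOn (fun i : Fin k => r i.succ) (t := {3, 4}) ?_ ?_).trans
    Finset.card_le_two
  · intro i hi
    have hi := hu i (by simpa using hi)
    have := h2 i.castSucc
    have := h4 i.succ
    simp only [Finset.coe_insert, Finset.coe_singleton, Set.mem_insert_iff, Set.mem_singleton_iff]
    omega
  · have aux : ∀ i j : Fin k, u j.castSucc ≠ u j.succ → i < j → r i.succ ≠ r j.succ := by
      intro i j hj hij
      exact ((hr (Fin.succ_le_castSucc_iff.2 hij)).trans_lt (hu j hj)).ne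
    intro i hi j hj hij
    have hi : u i.castSucc ≠ u i.succ := by simpa using hi
    have hj : u j.castSucc ≠ u j.succ := by simpa using hj
    rcases lt_trichotomy i j with h | h | h
    · exact absurd hij (aux i j hj h)
    · exact h
    · exact absurd hij.symm (aux j i hi h)

open Classical in
/-- The colour of a multihomomorphism `K₂ → K₄`: whether the smallest of all the vertices
used belongs to the first vertex of `K₂`. -/
noncomputable def multiHomColor (m : MultiHom K2 K4) : Bool :=
  decide (∃ a ∈ m.1 0, ∀ b ∈ m.1 1, a < b)

theorem multiHomColor_swap (m : MultiHom K2 K4) :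
    multiHomColor (multiHomSwap K4 m) = !multiHomColor m := by
  classical
  have e0 : (multiHomSwap K4 m).1 0 = m.1 1 :=
    congrArg m.1 (Equiv.swap_apply_left (0 : Fin 2) 1)
  have e1 : (multiHomSwap K4 m).1 1 = m.1 0 :=
    congrArg m.1 (Equiv.swap_apply_right (0 : Fin 2) 1)
  unfold multiHomColor
  rw [e0, e1, ← decide_not, decide_eq_decide]
  constructor
  · rintro ⟨a, ha, h⟩ ⟨b, hb, h'⟩
    exact (h b hb).asymm (h' a ha)
  · intro h
    push Not at h
    obtain ⟨a, ha, hmin⟩ := (Set.toFinite (m.1 1)).exists_minimal (m.2.1 1)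
    refine ⟨a, ha, fun b hb => ?_⟩
    obtain ⟨c, hc, hcb⟩ := h b hb
    refine lt_of_le_of_ne (le_trans ?_ hcb) ?_
    · exact (le_total a c).elim id fun h => hmin hc h
    · rintro rfl
      exact Set.disjoint_left.1 (multiHom_disjoint m) hb ha

/-- The map `Hom(K₂, K₄) → Σ²` given by an equivariant colouring of the vertices. Chains of
multihomomorphisms have at most three distinct members, so any colouring extends. -/
noncomputable def homComplexToSigma : Z2SSet.Map (homComplex K4) (sigma 2) :=
  ⟨{ app := fun U => TypeCat.ofHom fun (s : (nerve (MultiHom K2 K4)).obj U) =>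
      ⟨fun i => multiHomColor (s.obj i), by
        refine alternations_le_two (r := fun i => multiHomRank (s.obj i))
          (multiHomRank_strictMono.monotone.comp (nerve_monotone (n := U.unop.len) s))
          (fun i => two_le_multiHomRank _) (fun i => multiHomRank_le_four _) fun i hi => ?_
        refine multiHomRank_strictMono (lt_of_le_of_ne
          (nerve_monotone (n := U.unop.len) s (Fin.castSucc_le_succ i)) fun h => hi ?_)
        exact congrArg multiHomColor h⟩
     naturality := fun _ _ _ => rfl }, by
    refine NatTrans.ext (funext fun U => ConcreteCategory.hom_ext _ _
      fun (s : (nerve (MultiHom K2 K4)).obj U) => Subtype.ext (funext fun i => ?_))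
    exact multiHomColor_swap (s.obj i)⟩

/-- A monotone equivariant map of posets induces an equivariant map of order complexes. -/
def orderComplexMap {P Q : Type} [PartialOrder P] [PartialOrder Q] {ν : P →o P}
    {hν : ∀ x, ν (ν x) = x} {ν' : Q →o Q} {hν' : ∀ x, ν' (ν' x) = x} (f : P →o Q)
    (hf : ∀ x, f (ν x) = ν' (f x)) :
    Z2SSet.Map (orderComplex P ν hν) (orderComplex Q ν' hν') :=
  ⟨nerveMap f.monotone.functor, by
    refine NatTrans.ext (funext fun U => ConcreteCategory.hom_ext _ _
      fun (s : (nerve P).obj U) => nerve_ext (n := U.unop.len) fun i => ?_)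
    exact hf (s.obj i)⟩

theorem isIso_nerveMap {P Q : Type} [PartialOrder P] [PartialOrder Q] (f : P ≃o Q) :
    IsIso (nerveMap f.monotone.functor) := by
  refine ⟨nerveMap f.symm.monotone.functor, ?_, ?_⟩
  · refine NatTrans.ext (funext fun U => ConcreteCategory.hom_ext _ _
      fun (s : (nerve P).obj U) => nerve_ext (n := U.unop.len) fun i => ?_)
    exact f.symm_apply_apply (s.obj i)
  · refine NatTrans.ext (funext fun U => ConcreteCategory.hom_ext _ _
      fun (s : (nerve Q).obj U) => nerve_ext (n := U.unop.len) fun i => ?_)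
    exact f.apply_symm_apply (s.obj i)

/-- The equivariant isomorphism `Γ_{4ℓ} ≅ Hom(K₂, C_ℓ)`. -/
noncomputable def gammaToHom {ℓ : ℕ} (hodd : Odd ℓ) (hℓ : 3 ≤ ℓ) :
    Z2SSet.Map (gammaFour ℓ) (homComplex (cycle ℓ)) :=
  orderComplexMap ⟨gammaIso hodd hℓ, (gammaIso hodd hℓ).monotone⟩ (gammaIso_shift hodd hℓ)

theorem isIso_gammaToHom {ℓ : ℕ} (hodd : Odd ℓ) (hℓ : 3 ≤ ℓ) : IsIso (gammaToHom hodd hℓ).1 :=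
  isIso_nerveMap (gammaIso hodd hℓ)

theorem isMinion_pol {ℓ : ℕ} (hℓ : 3 ≤ ℓ) : (pol (cycle ℓ) K4).IsMinion := fun n =>
  let c := SimpleGraph.cycleGraph.tricoloring ℓ (by omega)
  ⟨⟨fun x => (c (x ⟨0, n.pos⟩)).castSucc, fun _ _ h => (K4_adj_iff _ _).2 fun e =>
    c.valid (h ⟨0, n.pos⟩) (Fin.castSucc_injective 3 e)⟩⟩

/-! ### The realization homomorphism -/

section
variable {P : Type} [PartialOrder P] [Finite P] {ν : P →o P} {hν : ∀ x, ν (ν x) = x}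
  (h : circle ≃ₜ (orderComplex P ν hν).realization)

/-- The homeomorphism of the torus with the realization of the power of an order complex, induced
by a homeomorphism of the circle with the realization of the order complex. -/
noncomputable def torusHomeo (n : ℕ) :
    circle.pow n ≃ₜ ((orderComplex P ν hν).pow n).realization :=
  (Homeomorph.piCongrRight fun _ : Fin n => h).trans (spowHomeo P n).symm

theorem realize_spowProj_torusHomeo (n : ℕ) (z : circle.pow n) (i : Fin n) :
    realize (spowProj (nerve P) n i) (torusHomeo h n z) = h (z i) :=
  congrFun ((spowHomeo P n).apply_symm_apply fun i => h (z i)) i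

/-- Points of the realization of a power are determined by their projections. -/
theorem eq_torusHomeo {n : ℕ} {z : circle.pow n} {x : ((orderComplex P ν hν).pow n).realization}
    (hx : ∀ i, realize (spowProj (nerve P) n i) x = h (z i)) : x = torusHomeo h n z :=
  (spowHomeo P n).injective (funext fun i =>
    (hx i).trans (realize_spowProj_torusHomeo h n z i).symm)

theorem torusHomeo_inv
    (heq : ∀ z, h (circle.inv z) = (orderComplex P ν hν).realization.inv (h z))
    (n : ℕ) (z : circle.pow n) : torusHomeo h n ((circle.pow n).inv z) =
      ((orderComplex P ν hν).pow n).realization.inv (torusHomeo h n z) := by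
  refine (eq_torusHomeo h fun i => ?_).symm
  refine (realize_comp ((orderComplex P ν hν).pow n).inv (spowProj (nerve P) n i) _).symm.trans ?_
  refine (realize_comp (spowProj (nerve P) n i) (orderComplex P ν hν).inv _).trans ?_
  rw [realize_spowProj_torusHomeo]
  exact (heq (z i)).symm

theorem realize_spowMap_torusHomeo {n m : ℕ} (π : Fin n → Fin m) (z : circle.pow m) :
    realize (spowMap (nerve P) π) (torusHomeo h m z) = torusHomeo h n (circle.powMap π z) := by
  refine eq_torusHomeo h fun i => ?_
  refine (realize_comp (spowMap (nerve P) π) (spowProj (nerve P) n i) _).symm.trans ?_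
  exact realize_spowProj_torusHomeo h m z (π i)

/-- The composition of the torus homeomorphism, the realization of a simplicial map, and an
equivariant map to a fixed space. -/
noncomputable def torusMap
    (heq : ∀ z, h (circle.inv z) = (orderComplex P ν hν).realization.inv (h z))
    {Z : Z2SSet} {Y : Z2Space} (j : Z2Space.Map Z.realization Y) {n : ℕ+}
    (g : (spol (orderComplex P ν hν) Z).obj n) : Z2Space.Map (circle.pow n) Y :=
  ⟨j.1.comp ((realize g.1).comp ⟨torusHomeo h n, (torusHomeo h n).continuous⟩), fun z => by
    change j.1 (realize g.1 (torusHomeo h n _)) = Y.inv (j.1 (realize g.1 (torusHomeo h n z)))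
    rw [torusHomeo_inv h heq]
    exact (congrArg j.1 (realize_equivariant g _)).trans (j.2 _)⟩

/-- Geometric realization as a minion homomorphism. -/
noncomputable def realizationHom
    (heq : ∀ z, h (circle.inv z) = (orderComplex P ν hν).realization.inv (h z))
    {Z : Z2SSet} {Y : Z2Space} (j : Z2Space.Map Z.realization Y) :
    MinionHom (spol (orderComplex P ν hν) Z) (hpol circle Y) where
  app n g := Quotient.mk _ (torusMap h heq j g)
  map_minor {n m} π g := by
    refine congrArg (Quotient.mk _) (Subtype.ext (ContinuousMap.ext fun z => congrArg j.1 ?_))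
    refine (realize_comp (spowMap (nerve P) π) g.1 _).trans ?_
    exact congrArg (realize g.1) (realize_spowMap_torusHomeo h π z)

/-- Vertexwise comparable maps to an order complex have the same class after composition
with `t`. -/
theorem realizationHom_eq_of_le
    (heq : ∀ z, h (circle.inv z) = (orderComplex P ν hν).realization.inv (h z))
    {Z : Z2SSet} {Y : Z2Space} (j : Z2Space.Map Z.realization Y) {n : ℕ+}
    {R : Type} [PartialOrder R] {ν' : R →o R} {hν' : ∀ x, ν' (ν' x) = x}
    (t : Z2SSet.Map (orderComplex R ν' hν') Z)
    (A B : Z2SSet.Map ((orderComplex P ν hν).pow n) (orderComplex R ν' hν'))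
    (hAB : ∀ U (s : ((orderComplex P ν hν).pow n).sset.obj U) k,
      CategoryTheory.Functor.obj (A.1.app U s) k ≤ CategoryTheory.Functor.obj (B.1.app U s) k)
    (g g' : (spol (orderComplex P ν hν) Z).obj n) (hg : g.1 = A.1 ≫ t.1) (hg' : g'.1 = B.1 ≫ t.1) :
    (realizationHom h heq j).app n g = (realizationHom h heq j).app n g' := by
  have : ((orderComplex P ν hν).pow n).sset.Finite := spow_finite P n
  obtain ⟨H⟩ := homotopicWith_of_le (P := Fin n → P) (X := (orderComplex P ν hν).pow n)
    (spowNerve P n) (fun _ _ _ e => spowNerve_injective P n _ e) A B hAB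
  refine Quotient.sound ⟨{
    toFun := fun p => j.1 (realize t.1 (H (p.1, torusHomeo h n p.2)))
    continuous_toFun := ?_
    map_zero_left := fun z => ?_
    map_one_left := fun z => ?_
    prop' := fun τ z => ?_ }⟩
  · refine j.1.continuous.comp ((realize t.1).continuous.comp (H.continuous.comp ?_))
    exact continuous_fst.prodMk ((torusHomeo h n).continuous.comp continuous_snd)
  · refine (congrArg (fun x => j.1 (realize t.1 x)) (H.map_zero_left _)).trans ?_
    change _ = j.1 (realize g.1 (torusHomeo h n z))
    rw [hg]
    exact congrArg j.1 (realize_comp _ _ _).symm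
  · refine (congrArg (fun x => j.1 (realize t.1 x)) (H.map_one_left _)).trans ?_
    change _ = j.1 (realize g'.1 (torusHomeo h n z))
    rw [hg']
    exact congrArg j.1 (realize_comp _ _ _).symm
  · change j.1 (realize t.1 (H (τ, torusHomeo h n ((circle.pow n).inv z)))) =
      Y.inv (j.1 (realize t.1 (H (τ, torusHomeo h n z))))
    rw [torusHomeo_inv h heq]
    refine (congrArg (fun x => j.1 (realize t.1 x)) (H.prop' τ _)).trans ?_
    exact (congrArg j.1 (realize_equivariant t _)).trans (j.2 _)

/-- The homomorphism `φ = η ∘ μ`. The assignment `μ` need not be a minion homomorphism,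
but `μ (f ^ π)` and `μ f ^ π` are vertexwise comparable before applying `t`. -/
noncomputable def polHom
    (heq : ∀ z, h (circle.inv z) = (orderComplex P ν hν).realization.inv (h z))
    {Z : Z2SSet} {Y : Z2Space} (j : Z2Space.Map Z.realization Y)
    {V W : Type} {G : SimpleGraph V} {H : SimpleGraph W}
    (e : Z2SSet.Map (orderComplex P ν hν) (homComplex G)) (t : Z2SSet.Map (homComplex H) Z) :
    MinionHom (pol G H) (hpol circle Y) where
  app n f := (realizationHom h heq j).app n (polToSpol e t f)
  map_minor {n m} π f := by
    rw [← (realizationHom h heq j).map_minor]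
    refine realizationHom_eq_of_le h heq j t (polToSpol e ⟨𝟙 _, rfl⟩ ((pol G H).minor π f))
      ((spol (orderComplex P ν hν) (homComplex H)).minor π (polToSpol e ⟨𝟙 _, rfl⟩ f))
      ?_ _ _ rfl rfl
    rintro U s k u w ⟨v, hv, rfl⟩
    exact ⟨v ∘ π, fun i => hv (π i), rfl⟩
end

end EqTop

theorem mainTheorem7 (ℓ : ℕ) (hodd : Odd ℓ) (hℓ : 3 ≤ ℓ) :
    -- the three families are minions, i.e. they are non-empty in every arity
    (pol (cycle ℓ) K4).IsMinion ∧ (spol (gammaFour ℓ) (sigma 2)).IsMinion ∧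
      (hpol circle emSpace).IsMinion ∧
    ∃ (φ : MinionHom (pol (cycle ℓ) K4) (hpol circle emSpace))
      (η : MinionHom (spol (gammaFour ℓ) (sigma 2)) (hpol circle emSpace)),
      (∀ n : ℕ+, Set.range (φ.app n) ⊆ Set.range (η.app n)) ∧
      -- `η g` is the class of `j ∘ |g|`, after identifying the torus with `|Γ ^ n|`
      (∃ (h : circle ≃ₜ (gammaFour ℓ).realization)
          (T : ∀ n : ℕ+, circle.pow n ≃ₜ ((gammaFour ℓ).pow n).realization),
        (∀ z, h (circle.inv z) = (gammaFour ℓ).realization.inv (h z)) ∧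
        (∀ (n : ℕ+) (z : circle.pow n) (i : Fin n),
          realize (spowProj (gammaFour ℓ).sset n i) (T n z) = h (z i)) ∧
        ∀ (n : ℕ+) (g : (spol (gammaFour ℓ) (sigma 2)).obj n),
          ∃ F : Z2Space.Map (circle.pow n) emSpace,
            (∀ z, F.1 z = emIncl.1 (realize g.1 (T n z))) ∧ η.app n g = Quotient.mk _ F) ∧
      -- `φ f = η (μ f)`, where `μ f : Γ ^ n ≅ Hom(K₂, C) ^ n → Hom(K₂, K₄) → Σ²`
      (∃ (e : Z2SSet.Map (gammaFour ℓ) (homComplex (cycle ℓ)))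
          (t : Z2SSet.Map (homComplex K4) (sigma 2)),
        IsIso e.1 ∧
        ∀ (n : ℕ+) (f : (pol (cycle ℓ) K4).obj n), φ.app n f = η.app n (polToSpol e t f)) := by
  have hNe : NeZero (4 * ℓ) := ⟨by omega⟩
  obtain ⟨h, heq⟩ := exists_circle_homeo (L := 4 * ℓ) (Dvd.intro ℓ rfl)
  let e := gammaToHom hodd hℓ
  let t := homComplexToSigma
  let η : MinionHom (spol (gammaFour ℓ) (sigma 2)) (hpol circle emSpace) :=
    realizationHom h heq emIncl
  let φ : MinionHom (pol (cycle ℓ) K4) (hpol circle emSpace) := polHom h heq emIncl e t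
  have hpolMinion := isMinion_pol hℓ
  refine ⟨hpolMinion, fun n => (hpolMinion n).map (polToSpol e t),
    fun n => (hpolMinion n).map (φ.app n),
    φ, η, ?_, ⟨h, fun n => torusHomeo h n, heq,
      fun n z i => realize_spowProj_torusHomeo h n z i, ?_⟩,
    e, t, isIso_gammaToHom hodd hℓ, fun _ _ => rfl⟩
  · rintro n _ ⟨f, rfl⟩
    exact ⟨polToSpol e t f, rfl⟩
  · exact fun n g => ⟨torusMap h heq emIncl g, fun _ => rfl, rfl⟩
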